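/- Let $d\ge 1$ and let $\mathscr D_d$ be the set of $d\times d$ complex density matrices (Hermitian positive semidefinite matrices of unit trace). Let $A$ be a random $d\times d$ Hermitian positive semidefinite matrix with $A\neq 0$ almost surely and $\mathbb E\,|\log\operatorname{tr}A|<\infty$, and let $$f(\rho)=\mathbb E[-\log\operatorname{tr}(A\rho)]\in(-\infty,+\infty],\qquad \nabla f(\rho)=-\mathbb E\Big[\frac{A}{\operatorname{tr}(A\rho)}\Big]\quad(\rho\succ0),$$ with the convention $-\log 0=+\infty$. Let $h(\rho)=-\log\det\rho-d\log d$ be the logarithmic barrier (equal to $+\infty$ at singular $\rho\in\mathscr D_d$), let $\|X\|_\rho=\sqrt{D^2h(\rho)[X,X]}$ be its local norm at $\rho\succ 0$ on Hermitian matrices, let $\|X\|_{\rho,*}=\sup\{|\operatorname{tr}(XT)| : T=T^*,\ \|T\|_\rho\le 1\}$ be the dual local norm, and let $\alpha_\rho(U)=-\operatorname{tr}(\rho U\rho)/\operatorname{tr}(\rho^2)$. Stochastic dual averaging with the logarithmic barrier produces $\rho_1=I/d$ and, for $t\ge1$, after receiving a random Hermitian matrix $g_t$ (a stochastic gradient at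 $\rho_t$), $$\rho_{t+1}\in\operatorname*{arg\,min}_{\rho\in\mathscr D_d}\ \eta_t\sum_{\tau=1}^t\operatorname{tr}(g_\tau\rho)+h(\rho),\qquad \eta_t=\frac{\sqrt d}{\sqrt{\sum_{\tau=1}^t\|g_\tau+\alpha_{\rho_\tau}(g_\tau)I\|_{\rho_\tau,*}^2+4dG^2+G^2}} ,$$ and outputs the averages $\bar\rho_t=\frac1t\sum_{\tau=1}^t\rho_\tau$. Let $\mathcal H_t=\sigma(g_1,\dots,g_{t-1},\rho_1,\dots,\rho_t)$ and assume that, almost surely and for every $t\ge1$, the stochastic first-order oracle is - unbiased: $g_t$ is integrable and $\mathbb E[g_t\mid\mathcal H_t]=\nabla f(\rho_t)$; - bounded: $\|g_t\|_{\rho_t,*}\le G$; - of bounded variance: $\mathbb E\big[\|g_t-\nabla f(\rho_t)\|_{\rho_t,*}^2\mid\mathcal H_t\big]\le\sigma^2$. Then $f$ attains a finite minimum over $\mathscr D_d$, and for every $t\ge 1$ $$\mathbb E\Big[f(\bar\rho_t)-\min_{\rho\in\mathscr D_d}f(\rho)\Big]\ \le\ \frac{4d(3+\log t)^3+2(3+\log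 t)\sqrt{\sigma^2dt+4d^2G^2+dG^2}+1}{t}.$$ -/

import Mathlib

open MeasureTheory ProbabilityTheory
open scoped ENNReal Matrix ComplexOrder

noncomputable section

namespace LogLossSDA

/-- The set of `d × d` density matrices: (complex, Hermitian) positive semidefinite matrices of
unit trace. -/
def densityMatrices (d : ℕ) : Set (Matrix (Fin d) (Fin d) ℂ) :=
  {ρ | ρ.PosSemidef ∧ ρ.trace = 1}

/-- The expectation of an extended-real random variable: the integral of the positive part minus
the integral of the negative part. -/
def expectation {Ω : Type*} [MeasurableSpace Ω] (μ : Measure Ω) (X : Ω → EReal) : EReal :=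
  ((∫⁻ ω, (X ω).toENNReal ∂μ : ℝ≥0∞) : EReal) - ((∫⁻ ω, (-X ω).toENNReal ∂μ : ℝ≥0∞) : EReal)

/-- The expected logarithmic loss `f(ρ) = 𝔼[-log tr(Aρ)]`, with the convention `-log 0 = +∞`. -/
def expLogLoss {Ξ : Type*} [MeasurableSpace Ξ] (P : Measure Ξ) {d : ℕ}
    (A : Ξ → Matrix (Fin d) (Fin d) ℂ) (ρ : Matrix (Fin d) (Fin d) ℂ) : EReal :=
  expectation P fun ξ => -ENNReal.log (ENNReal.ofReal (A ξ * ρ).trace.re)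

/-- The gradient `∇f(ρ) = -𝔼[A / tr(Aρ)]` of the expected logarithmic loss at a positive definite
`ρ`, for the Hilbert-Schmidt inner product on Hermitian matrices; that it is the gradient is
`hasDerivAt_expLogLoss` below. -/
def lossGradient {Ξ : Type*} [MeasurableSpace Ξ] (P : Measure Ξ) {d : ℕ}
    (A : Ξ → Matrix (Fin d) (Fin d) ℂ) (ρ : Matrix (Fin d) (Fin d) ℂ) :
    Matrix (Fin d) (Fin d) ℂ :=
  Matrix.of fun i j => -∫ ξ, A ξ i j / (((A ξ * ρ).trace.re : ℝ) : ℂ) ∂P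

open scoped MatrixOrder Matrix.Norms.L2Operator in
lemma exists_factor_of_posSemidef {d : ℕ} {A : Matrix (Fin d) (Fin d) ℂ} (hA : A.PosSemidef) :
    ∃ B : Matrix (Fin d) (Fin d) ℂ, A = Bᴴ * B :=
  CStarAlgebra.nonneg_iff_eq_star_mul_self.mp hA.nonneg

lemma posSemidef_sub_smul_one {d : ℕ} {H : Matrix (Fin d) (Fin d) ℂ} (hH : H.IsHermitian) {c : ℝ}
    (hc : ∀ i, c ≤ hH.eigenvalues i) : (H - c • (1 : Matrix (Fin d) (Fin d) ℂ)).PosSemidef := by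
  have h1 := hH.spectral_theorem
  rw [Unitary.conjStarAlgAut_apply] at h1
  have h2 : H - c • (1 : Matrix (Fin d) (Fin d) ℂ) =
      (hH.eigenvectorUnitary : Matrix (Fin d) (Fin d) ℂ) *
        Matrix.diagonal (fun i => ((hH.eigenvalues i - c : ℝ) : ℂ)) *
        (hH.eigenvectorUnitary : Matrix (Fin d) (Fin d) ℂ)ᴴ := by
    have h3 : Matrix.diagonal (fun i => ((hH.eigenvalues i - c : ℝ) : ℂ)) =
        Matrix.diagonal (RCLike.ofReal ∘ hH.eigenvalues) -
          c • (1 : Matrix (Fin d) (Fin d) ℂ) := by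
      ext i j
      by_cases hij : i = j
      · subst hij; simp
      · simp [hij]
    rw [h3, mul_sub, sub_mul, ← Matrix.star_eq_conjTranspose, ← h1]
    simp
  rw [h2]
  apply Matrix.PosSemidef.mul_mul_conjTranspose_same
  apply Matrix.PosSemidef.diagonal
  intro i
  simpa using hc i

lemma trace_mul_re_nonneg {d : ℕ} {A B : Matrix (Fin d) (Fin d) ℂ} (hA : A.PosSemidef)
    (hB : B.PosSemidef) : 0 ≤ (A * B).trace.re := by
  obtain ⟨C, rfl⟩ := exists_factor_of_posSemidef hB
  rw [← mul_assoc, Matrix.trace_mul_comm, ← mul_assoc]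
  exact (Complex.le_def.mp (hA.mul_mul_conjTranspose_same C).trace_nonneg).1

lemma exists_trace_bound {d : ℕ} {X : Matrix (Fin d) (Fin d) ℂ} (hX : X.IsHermitian) :
    ∃ K : ℝ, 0 ≤ K ∧ ∀ A : Matrix (Fin d) (Fin d) ℂ, A.PosSemidef →
      |(A * X).trace.re| ≤ K * A.trace.re := by
  have key : ∀ {H : Matrix (Fin d) (Fin d) ℂ} (_ : H.IsHermitian), ∃ K : ℝ, 0 ≤ K ∧
      ∀ A : Matrix (Fin d) (Fin d) ℂ, A.PosSemidef → -(A * H).trace.re ≤ K * A.trace.re := by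
    intro H hH
    refine ⟨∑ i, |hH.eigenvalues i|, Finset.sum_nonneg fun _ _ => abs_nonneg _, fun A hA => ?_⟩
    have h := trace_mul_re_nonneg hA (posSemidef_sub_smul_one hH
      (c := -∑ i, |hH.eigenvalues i|) (fun i => by
        have := Finset.single_le_sum (f := fun i => |hH.eigenvalues i|)
          (fun _ _ => abs_nonneg _) (Finset.mem_univ i)
        have := neg_abs_le (hH.eigenvalues i)
        linarith))
    simp only [neg_smul, sub_neg_eq_add, mul_add, Matrix.trace_add, Complex.add_re,
      Matrix.mul_smul, mul_one, Matrix.trace_smul, Complex.smul_re, smul_eq_mul] at h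
    linarith
  obtain ⟨K, hK, h1⟩ := key hX
  obtain ⟨L, hL, h2⟩ := key hX.neg
  refine ⟨K + L, by positivity, fun A hA => ?_⟩
  have h3 := h1 A hA
  have h4 := h2 A hA
  have h5 : 0 ≤ A.trace.re := (Complex.le_def.mp hA.trace_nonneg).1
  simp at h4
  rw [abs_le]
  constructor <;> nlinarith [mul_nonneg hK h5, mul_nonneg hL h5]

lemma exists_trace_lower {d : ℕ} {ρ : Matrix (Fin d) (Fin d) ℂ} (hρ : ρ.PosDef) :
    ∃ c : ℝ, 0 < c ∧ ∀ A : Matrix (Fin d) (Fin d) ℂ, A.PosSemidef →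
      c * A.trace.re ≤ (A * ρ).trace.re := by
  obtain ⟨c, hc, h⟩ : ∃ c : ℝ, 0 < c ∧ ∀ i, c ≤ hρ.1.eigenvalues i := by
    rcases isEmpty_or_nonempty (Fin d) with he | he
    · exact ⟨1, one_pos, fun i => he.elim i⟩
    · obtain ⟨i, hi⟩ := Finite.exists_min hρ.1.eigenvalues
      exact ⟨_, hρ.eigenvalues_pos i, hi⟩
  refine ⟨c, hc, fun A hA => ?_⟩
  have h := trace_mul_re_nonneg hA (posSemidef_sub_smul_one hρ.1 h)
  simp [mul_sub, Matrix.trace_sub] at h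
  linarith

lemma norm_entry_le_trace {d : ℕ} {A : Matrix (Fin d) (Fin d) ℂ} (hA : A.PosSemidef)
    (i j : Fin d) : ‖A i j‖ ≤ A.trace.re := by
  obtain ⟨B, rfl⟩ := exists_factor_of_posSemidef hA
  have ht : (Bᴴ * B).trace.re = ∑ l, ∑ k, ‖B k l‖ ^ 2 := by
    simp [Matrix.trace, Matrix.mul_apply, ← Complex.normSq_eq_norm_sq, Complex.normSq_apply]
  have hcol : ∀ l, ∑ k, ‖B k l‖ ^ 2 ≤ (Bᴴ * B).trace.re := fun l => by
    rw [ht]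
    exact Finset.single_le_sum (f := fun l => ∑ k, ‖B k l‖ ^ 2) (fun _ _ => by positivity)
      (Finset.mem_univ l)
  have : ‖(Bᴴ * B) i j‖ ≤ ∑ k, (‖B k i‖ ^ 2 + ‖B k j‖ ^ 2) / 2 := by
    rw [Matrix.mul_apply]
    refine (norm_sum_le _ _).trans (Finset.sum_le_sum fun k _ => ?_)
    simp only [Matrix.conjTranspose_apply, norm_mul, norm_star]
    nlinarith [sq_nonneg (‖B k i‖ - ‖B k j‖)]
  rw [← Finset.sum_div, Finset.sum_add_distrib] at this
  linarith [hcol i, hcol j]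

lemma toReal_expectation_coe {Ω : Type*} [MeasurableSpace Ω] {μ : Measure Ω} {X : Ω → EReal}
    {Y : Ω → ℝ} (hY : Integrable Y μ) (hXY : ∀ᵐ ω ∂μ, X ω = (Y ω : EReal)) :
    (expectation μ X).toReal = ∫ ω, Y ω ∂μ := by
  have h1 : ∫⁻ ω, (X ω).toENNReal ∂μ = ∫⁻ ω, ENNReal.ofReal (Y ω) ∂μ :=
    lintegral_congr_ae (hXY.mono fun ω h => by
      simp only [h]; rw [EReal.toENNReal_of_ne_top (EReal.coe_ne_top _), EReal.toReal_coe])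
  have h2 : ∫⁻ ω, (-X ω).toENNReal ∂μ = ∫⁻ ω, ENNReal.ofReal (-Y ω) ∂μ :=
    lintegral_congr_ae (hXY.mono fun ω h => by
      simp only [h]
      rw [← EReal.coe_neg, EReal.toENNReal_of_ne_top (EReal.coe_ne_top _), EReal.toReal_coe])
  have hf1 : ∫⁻ ω, ENNReal.ofReal (Y ω) ∂μ ≠ ⊤ := hY.lintegral_lt_top.ne
  have hf2 : ∫⁻ ω, ENNReal.ofReal (-Y ω) ∂μ ≠ ⊤ := hY.neg.lintegral_lt_top.ne
  rw [expectation, h1, h2, integral_eq_lintegral_pos_part_sub_lintegral_neg_part hY,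
    EReal.toReal_sub] <;> simp [hf1, hf2]

/-- The matrix `lossGradient P A ρ` is the gradient of the expected logarithmic loss at the positive
definite matrix `ρ`. -/
theorem hasDerivAt_expLogLoss {Ξ : Type*} [MeasurableSpace Ξ] (P : Measure Ξ)
    [IsProbabilityMeasure P] {d : ℕ} (A : Ξ → Matrix (Fin d) (Fin d) ℂ)
    (hA_meas : ∀ i j, Measurable fun ξ => A ξ i j)
    (hA_psd : ∀ᵐ ξ ∂P, (A ξ).PosSemidef) (hA_ne : ∀ᵐ ξ ∂P, A ξ ≠ 0)
    (hA_log : Integrable (fun ξ => Real.log (A ξ).trace.re) P)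
    {ρ X : Matrix (Fin d) (Fin d) ℂ} (hρ : ρ.PosDef) (hX : X.IsHermitian) :
    HasDerivAt (fun s : ℝ => (expLogLoss P A (ρ + s • X)).toReal)
      (lossGradient P A ρ * X).trace.re 0 := by
  obtain ⟨c, hc, hlow⟩ := exists_trace_lower hρ
  obtain ⟨K, hK, hup⟩ := exists_trace_bound hX
  obtain ⟨L, hL, hupρ⟩ := exists_trace_bound hρ.1
  have hmtr : ∀ Y : Matrix (Fin d) (Fin d) ℂ, Measurable fun ξ => (A ξ * Y).trace.re := by
    intro Y
    simp only [Matrix.trace, Matrix.diag, Matrix.mul_apply]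
    exact Complex.measurable_re.comp (Finset.measurable_sum _ fun i _ =>
      Finset.measurable_sum _ fun j _ => (hA_meas i j).mul_const _)
  have htr : ∀ᵐ ξ ∂P, 0 < (A ξ).trace.re := by
    filter_upwards [hA_psd, hA_ne] with ξ h1 h2
    have h3 := Complex.le_def.mp h1.trace_nonneg
    refine lt_of_le_of_ne h3.1 fun h4 => h2 (h1.trace_eq_zero_iff.mp ?_)
    exact Complex.ext h4.symm h3.2.symm
  set δ : ℝ := c / (2 * (K + 1)) with hδ
  have hδ0 : 0 < δ := by positivity
  have hδK : δ * (K + 1) = c / 2 := by rw [hδ]; field_simp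
  have hexp : ∀ (ξ : Ξ) (s : ℝ), (A ξ * (ρ + s • X)).trace.re =
      (A ξ * ρ).trace.re + s * (A ξ * X).trace.re := by
    intro ξ s
    simp [mul_add, Matrix.trace_add]
  have hball : ∀ s ∈ Metric.ball (0 : ℝ) δ, ∀ᵐ ξ ∂P,
      c / 2 * (A ξ).trace.re ≤ (A ξ * (ρ + s • X)).trace.re := by
    intro s hs
    have hs' : |s| < δ := by simpa using hs
    filter_upwards [hA_psd, htr] with ξ h1 h2
    rw [hexp]
    have h3 := hlow _ h1
    have h4 := hup _ h1
    have h5 : |s * (A ξ * X).trace.re| ≤ δ * (K * (A ξ).trace.re) := by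
      rw [abs_mul]; gcongr
    have h6 := neg_abs_le (s * (A ξ * X).trace.re)
    nlinarith [mul_pos hδ0 h2]
  have hball' : ∀ᵐ ξ ∂P, ∀ s ∈ Metric.ball (0 : ℝ) δ,
      c / 2 * (A ξ).trace.re ≤ (A ξ * (ρ + s • X)).trace.re := by
    filter_upwards [hA_psd, htr] with ξ h1 h2 s hs
    have hs' : |s| < δ := by simpa using hs
    rw [hexp]
    have h3 := hlow _ h1
    have h4 := hup _ h1
    have h5 : |s * (A ξ * X).trace.re| ≤ δ * (K * (A ξ).trace.re) := by
      rw [abs_mul]; gcongr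
    have h6 := neg_abs_le (s * (A ξ * X).trace.re)
    nlinarith [mul_pos hδ0 h2]
  have hint : ∀ s ∈ Metric.ball (0 : ℝ) δ,
      Integrable (fun ξ => -Real.log (A ξ * (ρ + s • X)).trace.re) P := by
    intro s hs
    have hs' : |s| < δ := by simpa using hs
    have hb : Integrable (fun ξ => |Real.log (A ξ).trace.re| +
        (|Real.log (c / 2)| + |Real.log (L + δ * K + 1)|)) P :=
      hA_log.abs.add (integrable_const _)
    refine hb.mono' (Real.measurable_log.comp (hmtr _)).neg.aestronglyMeasurable ?_
    filter_upwards [hball s hs, hA_psd, htr] with ξ h0 h1 h2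
    have hpos : 0 < (A ξ * (ρ + s • X)).trace.re := lt_of_lt_of_le (by positivity) h0
    have hu : (A ξ * (ρ + s • X)).trace.re ≤ (L + δ * K + 1) * (A ξ).trace.re := by
      rw [hexp]
      have h3 := (le_abs_self _).trans (hupρ _ h1)
      have h5 : s * (A ξ * X).trace.re ≤ δ * (K * (A ξ).trace.re) := by
        refine (le_abs_self _).trans ?_
        rw [abs_mul]
        have := hup _ h1
        gcongr
      nlinarith
    have hl1 := Real.log_le_log (by positivity) h0
    have hl2 := Real.log_le_log hpos hu
    rw [Real.log_mul (by positivity) h2.ne'] at hl1 hl2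
    rw [norm_neg, Real.norm_eq_abs, abs_le]
    have a1 := abs_le.mp (le_refl |Real.log (A ξ).trace.re|)
    have a2 := abs_le.mp (le_refl |Real.log (c / 2)|)
    have a3 := abs_le.mp (le_refl |Real.log (L + δ * K + 1)|)
    have b2 := abs_nonneg (Real.log (c / 2))
    have b3 := abs_nonneg (Real.log (L + δ * K + 1))
    constructor <;> linarith [a1.1, a1.2, a2.1, a2.2, a3.1, a3.2]
  have hmain := (hasDerivAt_integral_of_dominated_loc_of_deriv_le (μ := P)
    (F := fun (s : ℝ) ξ => -Real.log (A ξ * (ρ + s • X)).trace.re)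
    (F' := fun (s : ℝ) ξ => -((A ξ * X).trace.re / (A ξ * (ρ + s • X)).trace.re))
    (x₀ := (0 : ℝ)) (bound := fun _ => 2 * K / c) (Metric.ball_mem_nhds _ hδ0)
    (Filter.Eventually.of_forall fun s =>
      (Real.measurable_log.comp (hmtr _)).neg.aestronglyMeasurable)
    (hint 0 (Metric.mem_ball_self hδ0))
    ((hmtr _).div (hmtr _)).neg.aestronglyMeasurable
    (by
      filter_upwards [hball', hA_psd, htr] with ξ h0 h1 h2 s hs
      have h3 := h0 s hs
      have hpos : 0 < (A ξ * (ρ + s • X)).trace.re := lt_of_lt_of_le (by positivity) h3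
      rw [norm_neg, norm_div, Real.norm_eq_abs, Real.norm_eq_abs, abs_of_pos hpos,
        div_le_div_iff₀ hpos hc]
      have h4 := hup _ h1
      nlinarith)
    (integrable_const _)
    (by
      filter_upwards [hball', htr] with ξ h0 h2 s hs
      have h3 := h0 s hs
      have hpos : 0 < (A ξ * (ρ + s • X)).trace.re := lt_of_lt_of_le (by positivity) h3
      refine HasDerivAt.neg (HasDerivAt.log ?_ hpos.ne')
      simp only [hexp]
      simpa using ((hasDerivAt_id s).mul_const (A ξ * X).trace.re).const_add
        (A ξ * ρ).trace.re)).2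
  have hval : (lossGradient P A ρ * X).trace.re =
      ∫ ξ, -((A ξ * X).trace.re / (A ξ * (ρ + (0 : ℝ) • X)).trace.re) ∂P := by
    have hi : ∀ i j, Integrable (fun ξ => A ξ i j / (((A ξ * ρ).trace.re : ℝ) : ℂ)) P := by
      intro i j
      refine Integrable.of_bound ((hA_meas i j).div
        (Complex.measurable_ofReal.comp (hmtr ρ))).aestronglyMeasurable (1 / c) ?_
      filter_upwards [hA_psd, htr] with ξ h1 h2
      have h3 := hlow _ h1
      have hpos : 0 < (A ξ * ρ).trace.re := lt_of_lt_of_le (by positivity) h3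
      rw [norm_div, Complex.norm_real, Real.norm_eq_abs, abs_of_pos hpos,
        div_le_div_iff₀ hpos hc]
      have := norm_entry_le_trace h1 i j
      nlinarith
    have hq : ∀ i j, Integrable
        (fun ξ => -(A ξ i j / (((A ξ * ρ).trace.re : ℝ) : ℂ) * X j i)) P :=
      fun i j => ((hi i j).mul_const (X j i)).neg
    have e1 : (lossGradient P A ρ * X).trace =
        ∑ i, ∑ j, ∫ ξ, -(A ξ i j / (((A ξ * ρ).trace.re : ℝ) : ℂ) * X j i) ∂P := by
      simp only [Matrix.trace, Matrix.diag, Matrix.mul_apply, lossGradient, Matrix.of_apply]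
      refine Finset.sum_congr rfl fun i _ => Finset.sum_congr rfl fun j _ => ?_
      rw [integral_neg, integral_mul_const, neg_mul]
    have e2 : ∀ ξ, ∑ i, ∑ j, (-(A ξ i j / (((A ξ * ρ).trace.re : ℝ) : ℂ) * X j i)).re =
        -((A ξ * X).trace.re / (A ξ * (ρ + (0 : ℝ) • X)).trace.re) := by
      intro ξ
      have h0 : ρ + (0 : ℝ) • X = ρ := by simp
      rw [h0, ← Complex.div_ofReal_re, ← Complex.neg_re]
      generalize (((A ξ * ρ).trace.re : ℝ) : ℂ) = z
      simp only [Matrix.trace, Matrix.diag, Matrix.mul_apply, ← Complex.re_sum,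
        Finset.sum_div, ← Finset.sum_neg_distrib, div_mul_eq_mul_div]
    have e3 : ∀ i j, (∫ ξ, -(A ξ i j / (((A ξ * ρ).trace.re : ℝ) : ℂ) * X j i) ∂P).re =
        ∫ ξ, (-(A ξ i j / (((A ξ * ρ).trace.re : ℝ) : ℂ) * X j i)).re ∂P :=
      fun i j => (integral_re (hq i j)).symm
    have hqr : ∀ i j, Integrable
        (fun ξ => (-(A ξ i j / (((A ξ * ρ).trace.re : ℝ) : ℂ) * X j i)).re) P :=
      fun i j => (hq i j).re
    simp only [← e2]
    rw [e1, integral_finsetSum _ fun i _ => integrable_finsetSum _ fun j _ => hqr i j,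
      Complex.re_sum]
    refine Finset.sum_congr rfl fun i _ => ?_
    rw [integral_finsetSum _ fun j _ => hqr i j, Complex.re_sum]
    exact Finset.sum_congr rfl fun j _ => e3 i j
  rw [hval]
  refine hmain.congr_of_eventuallyEq ?_
  filter_upwards [Metric.ball_mem_nhds (0 : ℝ) hδ0] with s hs
  refine toReal_expectation_coe (hint s hs) ?_
  filter_upwards [hball s hs, htr] with ξ h0 h2
  have hpos : 0 < (A ξ * (ρ + s • X)).trace.re := lt_of_lt_of_le (by positivity) h0
  rw [ENNReal.log_ofReal_of_pos hpos, EReal.coe_neg]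


/-- The logarithmic barrier `h(ρ) = -log det ρ - d log d`, equal to `+∞` at singular positive
semidefinite matrices. -/
def logBarrier {d : ℕ} (ρ : Matrix (Fin d) (Fin d) ℂ) : EReal :=
  -ENNReal.log (ENNReal.ofReal ρ.det.re) - (((d : ℝ) * Real.log d : ℝ) : EReal)

/-- The local norm `‖X‖_ρ = √(D²h(ρ)[X, X])` of a Hermitian matrix `X` at a positive definite
`ρ`. -/
def localNorm {d : ℕ} (ρ X : Matrix (Fin d) (Fin d) ℂ) : ℝ :=
  Real.sqrt (iteratedDeriv 2 (fun s : ℝ => (logBarrier (ρ + s • X)).toReal) 0)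

/-- The dual local norm `‖X‖_{ρ,*}`: the supremum of `|tr(X T)|` over the Hermitian `T` with
`‖T‖_ρ ≤ 1`. -/
def dualLocalNorm {d : ℕ} (ρ X : Matrix (Fin d) (Fin d) ℂ) : ℝ :=
  sSup {r : ℝ | ∃ T : Matrix (Fin d) (Fin d) ℂ, T.IsHermitian ∧ localNorm ρ T ≤ 1 ∧
    r = |(X * T).trace.re|}

/-- `α_ρ(U) = -tr(ρUρ) / tr(ρ²)`, the minimizer of `α ↦ ‖U + α I‖_{ρ,*}` over the reals. -/
def alphaShift {d : ℕ} (ρ U : Matrix (Fin d) (Fin d) ℂ) : ℝ :=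
  -(ρ * U * ρ).trace.re / (ρ * ρ).trace.re

/-- The learning rate
`η_t = √d / √(∑_{τ=1}^t ‖g_τ + α_{ρ_τ}(g_τ) I‖²_{ρ_τ,*} + 4 d G² + G²)`. -/
def learningRate {d : ℕ} (G : ℝ) (g ρ : ℕ → Matrix (Fin d) (Fin d) ℂ) (t : ℕ) : ℝ :=
  Real.sqrt d / Real.sqrt
    ((∑ τ ∈ Finset.Icc 1 t,
        dualLocalNorm (ρ τ) (g τ + alphaShift (ρ τ) (g τ) • (1 : Matrix (Fin d) (Fin d) ℂ)) ^ 2)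
      + 4 * d * G ^ 2 + G ^ 2)

/-- `ρ₁, ρ₂, …` are the iterates of dual averaging with the logarithmic barrier, fed with the
gradient estimates `g₁, g₂, …`: `ρ₁ = I/d`, and for `t ≥ 1` the iterate `ρ_{t+1}` minimizes
`η_t ∑_{τ=1}^t tr(g_τ σ) + h(σ)` over the density matrices `σ`. (The index `0` is not used.) -/
structure IsDualAveraging {d : ℕ} (G : ℝ) (g ρ : ℕ → Matrix (Fin d) (Fin d) ℂ) : Prop where
  init : ρ 1 = (d : ℝ)⁻¹ • (1 : Matrix (Fin d) (Fin d) ℂ)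
  mem : ∀ t : ℕ, 1 ≤ t → ρ (t + 1) ∈ densityMatrices d
  isMinOn : ∀ t : ℕ, 1 ≤ t → IsMinOn
    (fun σ : Matrix (Fin d) (Fin d) ℂ =>
      ((learningRate G g ρ t * ∑ τ ∈ Finset.Icc 1 t, (g τ * σ).trace.re : ℝ) : EReal)
        + logBarrier σ)
    (densityMatrices d) (ρ (t + 1))

/-- The output of the online-to-batch conversion: the average `(1/t) ∑_{τ=1}^t ρ_τ`. -/
def averagedIterate {d : ℕ} (ρ : ℕ → Matrix (Fin d) (Fin d) ℂ) (t : ℕ) :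
    Matrix (Fin d) (Fin d) ℂ :=
  (t : ℝ)⁻¹ • ∑ τ ∈ Finset.Icc 1 t, ρ τ

/-- The σ-algebra generated by a random matrix (by its entries). -/
abbrev sigmaOf {Ω : Type*} {d : ℕ} (X : Ω → Matrix (Fin d) (Fin d) ℂ) : MeasurableSpace Ω :=
  ⨆ i, ⨆ j, MeasurableSpace.comap (fun ω => X ω i j) inferInstance

/-- The past information before `g_t` is obtained, `ℋ_t = σ(g₁, …, g_{t-1}, ρ₁, …, ρ_t)`. -/
abbrev history {Ω : Type*} {d : ℕ} (g ρ : ℕ → Ω → Matrix (Fin d) (Fin d) ℂ) (t : ℕ) :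
    MeasurableSpace Ω :=
  (⨆ τ ∈ Set.Ico 1 t, sigmaOf (g τ)) ⊔ (⨆ τ ∈ Set.Icc 1 t, sigmaOf (ρ τ))

/-- The random Hermitian matrices `g₁, g₂, …` are the answers, at the query points `ρ₁, ρ₂, …`, of
a stochastic first-order oracle for `f` that is unbiased, has dual local norm at most `G`, and has
variance at most `σ²` in the dual local norm. -/
structure IsStochasticOracle {Ω : Type*} [MeasurableSpace Ω] (μ : Measure Ω)
    {Ξ : Type*} [MeasurableSpace Ξ] (P : Measure Ξ) {d : ℕ}
    (A : Ξ → Matrix (Fin d) (Fin d) ℂ) (G σ : ℝ)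
    (g ρ : ℕ → Ω → Matrix (Fin d) (Fin d) ℂ) : Prop where
  isHermitian : ∀ t : ℕ, 1 ≤ t → ∀ ω, (g t ω).IsHermitian
  measurable : ∀ t : ℕ, 1 ≤ t → ∀ i j, Measurable fun ω => g t ω i j
  integrable : ∀ t : ℕ, 1 ≤ t → ∀ i j, Integrable (fun ω => g t ω i j) μ
  unbiased : ∀ t : ℕ, 1 ≤ t → ∀ i j,
    μ[fun ω => g t ω i j | history g ρ t] =ᵐ[μ] fun ω => lossGradient P A (ρ t ω) i j
  norm_le : ∀ t : ℕ, 1 ≤ t → ∀ᵐ ω ∂μ, dualLocalNorm (ρ t ω) (g t ω) ≤ G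
  variance_le : ∀ t : ℕ, 1 ≤ t →
    μ[fun ω => dualLocalNorm (ρ t ω) (g t ω - lossGradient P A (ρ t ω)) ^ 2 | history g ρ t]
      ≤ᵐ[μ] fun _ => σ ^ 2

end LogLossSDA

end

namespace LogLossSDA

/-! The proof combines a regret bound for dual averaging with a self-bounding property of the
logarithmic loss.

A congruence `P = Bᴴ * B`, `U = Bᴴ * Y * B` reduces the geometry of the barrier to eigenvalues of
`Y`. It shows that the local norm squared is `tr(ρ⁻¹Xρ⁻¹X)` and the dual one is `tr(UρUρ)`
(`localNorm_eq`, `dualLocalNorm_eq`). It also yields two scalar-type inequalities for `log det`: the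
Fenchel inequality `log_det_add_log_det_le`, from `log x ≤ x - 1`, and the quadratic lower bound
`posDef_add_and_log_det_ge` on a Dikin ellipsoid, from `u - u² ≤ log (1 + u)` for `|u| ≤ 1/2`.
Together they give the one-step inequality `realBarrier_step`. Multiples of the identity are
constant on density matrices, so the error in each step is the squared dual norm of the optimally
shifted gradient. Telescoping gives `regret_le`: against a comparator with `h ≤ dK`, the regret is
at most `√d (K + 2) √(V + G²)`, where `V` is `4dG²` plus the sum of the squared shifted norms.

The self-bounding property `IsLossData.dualForm_shifted_lossGradient_le` says that the squared
shifted norm of the true gradient at `ρ` is at most `4 (f(ρ) - min f)`: a step of length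
proportional to the shifted gradient stays among density matrices and decreases `f` by a quarter of
that square. Hence `V` is controlled by the oracle noise and by the suboptimality gaps themselves.

A minimizer `r` of `f` exists by Fatou's lemma and compactness, but it may be singular and have
infinite barrier. The comparator is therefore a mixture of `r` with `I/d`, which costs at most `1/t`
in the loss and has barrier at most `d (log t + 1)`. Taking expectations, unbiasedness turns the
regret into the sum `S` of linearized gaps. With `L = 3 + log t`, this gives `S ≤ 1 + L √(2B + 8dS)`
for the quantity `B` under the square root of the theorem (`integral_sum_gap_le`). Solving this
quadratic inequality in `√S` (`le_of_self_bounding`) and applying convexity of `f` finishes the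
proof. -/

/-- The quadratic form `tr(U ρ U ρ)`; its square root is the dual local norm of `U` at `ρ`. -/
noncomputable def dualForm {d : ℕ} (ρ U : Matrix (Fin d) (Fin d) ℂ) : ℝ :=
  (U * ρ * U * ρ).trace.re

/-! ### Spectral calculus for Hermitian matrices. -/

section Spectral

variable {d : ℕ} {H : Matrix (Fin d) (Fin d) ℂ}

lemma exists_unitary_diagonal (hH : H.IsHermitian) :
    ∃ V : Matrix (Fin d) (Fin d) ℂ, V * Vᴴ = 1 ∧ Vᴴ * V = 1 ∧
      H = V * Matrix.diagonal (fun i => (hH.eigenvalues i : ℂ)) * Vᴴ := by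
  have h1 := hH.spectral_theorem
  rw [Unitary.conjStarAlgAut_apply] at h1
  refine ⟨hH.eigenvectorUnitary, ?_, ?_, h1⟩
  · exact Unitary.mul_star_self_of_mem hH.eigenvectorUnitary.2
  · exact Unitary.star_mul_self_of_mem hH.eigenvectorUnitary.2

lemma trace_re_eq_sum (hH : H.IsHermitian) : H.trace.re = ∑ i, hH.eigenvalues i := by
  rw [hH.trace_eq_sum_eigenvalues]; simp

lemma trace_mul_self_re_eq_sum (hH : H.IsHermitian) :
    (H * H).trace.re = ∑ i, hH.eigenvalues i ^ 2 := by
  obtain ⟨V, -, h2, h3⟩ := exists_unitary_diagonal hH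
  generalize hH.eigenvalues = l at *
  have h : H * H = V * Matrix.diagonal (fun i => ((l i ^ 2 : ℝ) : ℂ)) * Vᴴ := by
    calc H * H = V * Matrix.diagonal (fun i => (l i : ℂ)) * (Vᴴ * V) *
          Matrix.diagonal (fun i => (l i : ℂ)) * Vᴴ := by rw [h3]; simp only [mul_assoc]
      _ = _ := by
        rw [h2, mul_one, mul_assoc V, Matrix.diagonal_mul_diagonal]
        simp [pow_two]
  rw [h, Matrix.trace_mul_comm, ← mul_assoc, h2, one_mul, Matrix.trace_diagonal, Complex.re_sum]
  simp only [Complex.ofReal_re]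

lemma one_add_smul_eq (hH : H.IsHermitian) (s : ℝ) :
    ∃ V : Matrix (Fin d) (Fin d) ℂ, V * Vᴴ = 1 ∧ Vᴴ * V = 1 ∧ 1 + s • H =
      V * Matrix.diagonal (fun i => ((1 + s * hH.eigenvalues i : ℝ) : ℂ)) * Vᴴ := by
  obtain ⟨V, h1, h2, h3⟩ := exists_unitary_diagonal hH
  refine ⟨V, h1, h2, ?_⟩
  generalize hH.eigenvalues = l at *
  have : Matrix.diagonal (fun i => ((1 + s * l i : ℝ) : ℂ)) =
      1 + s • Matrix.diagonal (fun i => (l i : ℂ)) := by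
    ext i j
    by_cases hij : i = j
    · subst hij; simp
    · simp [hij]
  rw [this, mul_add, add_mul, mul_one, h1, Matrix.mul_smul, Matrix.smul_mul, ← h3]

lemma det_one_add_smul (hH : H.IsHermitian) (s : ℝ) :
    (1 + s • H).det = ((∏ i, (1 + s * hH.eigenvalues i) : ℝ) : ℂ) := by
  obtain ⟨V, h1, -, h3⟩ := one_add_smul_eq hH s
  have h4 : V.det * Vᴴ.det = 1 := by rw [← Matrix.det_mul, h1, Matrix.det_one]
  rw [h3, Matrix.det_mul, Matrix.det_mul, mul_right_comm, h4, one_mul, Matrix.det_diagonal]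
  push_cast; rfl

lemma posDef_one_add (hH : H.IsHermitian) (h : ∀ i, 0 < 1 + hH.eigenvalues i) :
    (1 + H).PosDef := by
  obtain ⟨V, h1, h2, h3⟩ := one_add_smul_eq hH 1
  rw [one_smul] at h3
  have hV : IsUnit V := IsUnit.of_mul_eq_one _ h1
  rw [h3]
  refine (Matrix.IsUnit.posDef_star_right_conjugate_iff hV).2 (Matrix.PosDef.diagonal fun i => ?_)
  have := h i
  simp only [one_mul]
  exact_mod_cast this

lemma trace_mul_self_re_nonneg (hH : H.IsHermitian) : 0 ≤ (H * H).trace.re := by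
  rw [trace_mul_self_re_eq_sum hH]; positivity

lemma trace_mul_self_re_le_sq (hH : H.PosSemidef) : (H * H).trace.re ≤ H.trace.re ^ 2 := by
  rw [trace_mul_self_re_eq_sum hH.1, trace_re_eq_sum hH.1]
  exact Finset.sum_sq_le_sq_sum_of_nonneg fun i _ => hH.eigenvalues_nonneg i

/-- The Cauchy-Schwarz inequality for the Hilbert-Schmidt inner product. -/
lemma trace_mul_re_sq_le {X Y : Matrix (Fin d) (Fin d) ℂ} (hX : X.IsHermitian)
    (hY : Y.IsHermitian) :
    (X * Y).trace.re ^ 2 ≤ (X * X).trace.re * (Y * Y).trace.re := by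
  have key : ∀ s : ℝ, 0 ≤ (Y * Y).trace.re * (s * s) + 2 * (X * Y).trace.re * s +
      (X * X).trace.re := by
    intro s
    have h := trace_mul_self_re_nonneg (H := X + s • Y) (hX.add (by
      unfold Matrix.IsHermitian; rw [Matrix.conjTranspose_smul, hY.eq]; simp))
    have h2 : ((X + s • Y) * (X + s • Y)).trace.re = (Y * Y).trace.re * (s * s) +
        2 * (X * Y).trace.re * s + (X * X).trace.re := by
      simp only [add_mul, mul_add, Matrix.trace_add, Matrix.smul_mul, Matrix.mul_smul,
        Matrix.trace_smul, Complex.add_re, Complex.real_smul, Complex.re_ofReal_mul,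
        Matrix.trace_mul_comm Y X]
      ring
    rwa [h2] at h
  have := discrim_le_zero key
  rw [discrim] at this
  nlinarith

end Spectral

/-! ### Congruence, inequalities for `log det`, and closed forms of the local norms. -/

section Congruence

variable {d : ℕ} {P Q U V A : Matrix (Fin d) (Fin d) ℂ}

lemma exists_isUnit_factor (hP : P.PosDef) :
    ∃ B : Matrix (Fin d) (Fin d) ℂ, IsUnit B.det ∧ P = Bᴴ * B := by
  obtain ⟨B, rfl⟩ := exists_factor_of_posSemidef hP.posSemidef
  refine ⟨B, ?_, rfl⟩
  have := hP.det_pos.ne'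
  rw [Matrix.det_mul] at this
  exact (right_ne_zero_of_mul this).isUnit

/-- This normalizes a pair `(P, U)` to `(1, Y)`. Determinants, traces and the form `dualForm P⁻¹`
transform simply under congruence, so later claims become statements about the eigenvalues of `Y`.
-/
lemma exists_congruence (hP : P.PosDef) (hU : U.IsHermitian) :
    ∃ B Y : Matrix (Fin d) (Fin d) ℂ, IsUnit B.det ∧ P = Bᴴ * B ∧ Y.IsHermitian ∧
      U = Bᴴ * Y * B := by
  obtain ⟨B, hB, rfl⟩ := exists_isUnit_factor hP
  have hB' : IsUnit Bᴴ.det := by rw [Matrix.det_conjTranspose]; exact hB.star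
  refine ⟨B, B⁻¹ᴴ * U * B⁻¹, hB, rfl, Matrix.isHermitian_conjTranspose_mul_mul _ hU, ?_⟩
  rw [Matrix.conjTranspose_nonsing_inv]
  simp only [mul_assoc, Matrix.nonsing_inv_mul _ hB, mul_one]
  rw [← mul_assoc, Matrix.mul_nonsing_inv _ hB', one_mul]

lemma det_pos_re (hP : P.PosDef) : 0 < P.det.re := (Complex.lt_def.mp hP.det_pos).1

lemma det_eq_re (hP : P.PosSemidef) : P.det = (P.det.re : ℂ) :=
  Complex.ext rfl (Complex.le_def.mp hP.det_nonneg).2.symm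

/-- The first-order expansion of `log det`, in its Fenchel form. -/
lemma log_det_add_log_det_le (hP : P.PosDef) (hQ : Q.PosDef) :
    Real.log P.det.re + Real.log Q.det.re ≤ (P * Q).trace.re - d := by
  -- With `Q = Cᴴ * C`, the trace and determinant of `P * Q` are those of the positive definite
  -- matrix `C * P * Cᴴ`, so only `log x ≤ x - 1` at its eigenvalues is needed.
  obtain ⟨C, hC, rfl⟩ := exists_isUnit_factor hQ
  have hCu : IsUnit C := (Matrix.isUnit_iff_isUnit_det _).2 hC
  have hR : (C * P * Cᴴ).PosDef := (Matrix.IsUnit.posDef_star_right_conjugate_iff hCu).2 hP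
  have h1 : (P * (Cᴴ * C)).trace = (C * P * Cᴴ).trace := by
    rw [← mul_assoc, Matrix.trace_mul_comm, mul_assoc]
  have h2 : P.det.re * (Cᴴ * C).det.re = ∏ i, hR.1.eigenvalues i := by
    have : P.det * (Cᴴ * C).det = (C * P * Cᴴ).det := by
      simp only [Matrix.det_mul]; ring
    rw [det_eq_re hP.posSemidef, det_eq_re hQ.posSemidef, hR.1.det_eq_prod_eigenvalues] at this
    apply Complex.ofReal_injective
    push_cast
    exact this
  rw [← Real.log_mul (det_pos_re hP).ne' (det_pos_re hQ).ne', h2, h1, trace_re_eq_sum hR.1,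
    Real.log_prod fun i _ => (hR.eigenvalues_pos i).ne']
  calc ∑ i, Real.log (hR.1.eigenvalues i) ≤ ∑ i, (hR.1.eigenvalues i - 1) :=
        Finset.sum_le_sum fun i _ => Real.log_le_sub_one_of_pos (hR.eigenvalues_pos i)
    _ = _ := by simp

lemma sub_sq_le_log_one_add {u : ℝ} (hu : |u| ≤ 1 / 2) : u - u ^ 2 ≤ Real.log (1 + u) := by
  obtain ⟨h1, h2⟩ := abs_le.mp hu
  by_cases h0 : 0 ≤ u
  · have := Real.one_sub_inv_le_log_of_pos (show 0 < 1 + u by linarith)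
    have h5 : u - u ^ 2 ≤ 1 - (1 + u)⁻¹ := by
      rw [← sub_nonneg]
      have : 1 - (1 + u)⁻¹ - (u - u ^ 2) = u ^ 3 / (1 + u) := by
        field_simp; ring
      rw [this]; positivity
    linarith
  · push Not at h0
    obtain ⟨w, rfl⟩ : ∃ w, u = -w := ⟨-u, by ring⟩
    have hw : |w| = w := abs_of_pos (by linarith)
    -- Four Taylor terms are enough: for `w ≤ 1/2` the terms after `w` sum to at most `(1/2 + 1/6 +
    -- 1/16 + 1/4) w² < w²`, the last summand being the remainder `2w⁵`. Three terms with this crude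
    -- remainder would not do.
    have h6 := Real.abs_log_sub_add_sum_range_le (x := w) (by rw [hw]; linarith) 4
    simp only [Finset.sum_range_succ, Finset.sum_range_zero, hw] at h6
    have h7 : w ^ (4 + 1) / (1 - w) ≤ 2 * w ^ 5 := by
      rw [div_le_iff₀ (by linarith), show w ^ (4 + 1) = w ^ 5 from rfl]
      nlinarith [mul_nonneg (pow_pos (show 0 < w by linarith) 5).le
        (show 0 ≤ 1 - 2 * w by linarith)]
    have h8 := (abs_le.mp (h6.trans h7)).1
    norm_num at h8
    have h9 : w ^ 3 ≤ w ^ 2 * (1 / 2) := by nlinarith [sq_nonneg w]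
    have h10 : w ^ 4 ≤ w ^ 3 * (1 / 2) := by nlinarith [pow_pos (show 0 < w by linarith) 3]
    have h11 : w ^ 5 ≤ w ^ 4 * (1 / 2) := by nlinarith [pow_pos (show 0 < w by linarith) 4]
    rw [← sub_eq_add_neg]
    nlinarith

section Factor

variable {B Y : Matrix (Fin d) (Fin d) ℂ}

lemma congruence_mul_inv (hB : IsUnit B.det) :
    Bᴴ * Y * B * (Bᴴ * B)⁻¹ = Bᴴ * Y * Bᴴ⁻¹ := by
  rw [Matrix.mul_inv_rev, mul_assoc _ B, ← mul_assoc B, Matrix.mul_nonsing_inv _ hB, one_mul]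

lemma trace_congruence_mul_inv (hB : IsUnit B.det) :
    (Bᴴ * Y * B * (Bᴴ * B)⁻¹).trace = Y.trace := by
  have hB' : IsUnit Bᴴ.det := by rw [Matrix.det_conjTranspose]; exact hB.star
  rw [congruence_mul_inv hB, Matrix.trace_mul_comm, ← mul_assoc,
    Matrix.nonsing_inv_mul _ hB', one_mul]

lemma dualForm_congruence (hB : IsUnit B.det) :
    dualForm (Bᴴ * B)⁻¹ (Bᴴ * Y * B) = (Y * Y).trace.re := by
  have hB' : IsUnit Bᴴ.det := by rw [Matrix.det_conjTranspose]; exact hB.star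
  rw [dualForm, mul_assoc _ (Bᴴ * Y * B), congruence_mul_inv hB, mul_assoc (Bᴴ * Y),
    ← mul_assoc Bᴴ⁻¹, ← mul_assoc Bᴴ⁻¹, Matrix.nonsing_inv_mul _ hB', one_mul, mul_assoc Bᴴ,
    Matrix.trace_mul_comm, ← mul_assoc Y, mul_assoc, Matrix.nonsing_inv_mul _ hB', mul_one]

lemma dualForm_factor (U : Matrix (Fin d) (Fin d) ℂ) :
    dualForm (Bᴴ * B) U = ((B * U * Bᴴ) * (B * U * Bᴴ)).trace.re := by
  rw [dualForm, ← mul_assoc, Matrix.trace_mul_comm]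
  simp only [mul_assoc]

end Factor

/-- The second-order lower bound of `log det` in a Dikin ellipsoid. -/
lemma posDef_add_and_log_det_ge (hP : P.PosDef) (hU : U.IsHermitian)
    (h : dualForm P⁻¹ U ≤ 1 / 4) :
    (P + U).PosDef ∧
      Real.log P.det.re + (U * P⁻¹).trace.re - dualForm P⁻¹ U ≤ Real.log (P + U).det.re := by
  obtain ⟨B, Y, hB, rfl, hY, rfl⟩ := exists_congruence hP hU
  have hBu : IsUnit B := (Matrix.isUnit_iff_isUnit_det _).2 hB
  rw [dualForm_congruence hB] at h ⊢
  rw [trace_congruence_mul_inv hB]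
  rw [trace_mul_self_re_eq_sum hY] at h ⊢
  -- The squares of the eigenvalues sum to at most `1/4`, so each lies in the range of
  -- `sub_sq_le_log_one_add`.
  have hl : ∀ i, |hY.eigenvalues i| ≤ 1 / 2 := fun i => by
    have := (Finset.single_le_sum (f := fun i => hY.eigenvalues i ^ 2)
      (fun _ _ => sq_nonneg _) (Finset.mem_univ i)).trans h
    exact abs_le_of_sq_le_sq (by linarith) (by norm_num)
  have hl' : ∀ i, 0 < 1 + hY.eigenvalues i := fun i => by
    have := (abs_le.mp (hl i)).1; linarith
  have e3 : Bᴴ * B + Bᴴ * Y * B = Bᴴ * (1 + Y) * B := by simp [mul_add, add_mul]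
  have hpd : (Bᴴ * B + Bᴴ * Y * B).PosDef := by
    rw [e3]
    exact (Matrix.IsUnit.posDef_star_left_conjugate_iff hBu).2 (posDef_one_add hY hl')
  refine ⟨hpd, ?_⟩
  have e4 : (Bᴴ * B + Bᴴ * Y * B).det.re = (Bᴴ * B).det.re * ∏ i, (1 + hY.eigenvalues i) := by
    have h1 : (Bᴴ * B + Bᴴ * Y * B).det = (Bᴴ * B).det * (1 + Y).det := by
      rw [e3]; simp only [Matrix.det_mul]; ring
    have h2 := det_one_add_smul hY 1
    simp only [one_smul, one_mul] at h2
    rw [h1, h2, Complex.re_mul_ofReal]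
  rw [e4, Real.log_mul (det_pos_re hP).ne' (Finset.prod_pos fun i _ => hl' i).ne',
    Real.log_prod fun i _ => (hl' i).ne', trace_re_eq_sum hY, add_sub_assoc,
    ← Finset.sum_sub_distrib]
  gcongr with i
  exact sub_sq_le_log_one_add (hl i)

lemma dualForm_nonneg (hP : P.PosDef) (hU : U.IsHermitian) : 0 ≤ dualForm P U := by
  obtain ⟨B, hB, rfl⟩ := exists_isUnit_factor hP
  rw [dualForm_factor]
  exact trace_mul_self_re_nonneg (Matrix.isHermitian_mul_mul_conjTranspose _ hU)

lemma dualForm_smul (c : ℝ) : dualForm P (c • U) = c ^ 2 * dualForm P U := by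
  simp only [dualForm, Matrix.smul_mul, Matrix.mul_smul, Matrix.trace_smul, Complex.real_smul,
    Complex.re_ofReal_mul]
  ring

lemma dualForm_add : dualForm P (U + V) =
    dualForm P U + 2 * (U * P * V * P).trace.re + dualForm P V := by
  have : (V * P * U * P).trace = (U * P * V * P).trace := by
    rw [mul_assoc, Matrix.trace_mul_comm, mul_assoc (U * P)]
  simp only [dualForm, add_mul, mul_add, Matrix.trace_add, Complex.add_re, this]
  ring

/-- The parallelogram law, after dropping the nonnegative form at `U - V`. -/
lemma dualForm_add_le (hP : P.PosDef) (hU : U.IsHermitian) (hV : V.IsHermitian) :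
    dualForm P (U + V) ≤ 2 * dualForm P U + 2 * dualForm P V := by
  have h1 := dualForm_nonneg hP (hU.sub hV)
  have h2 := dualForm_add (P := P) (U := U) (V := (-1 : ℝ) • V)
  rw [dualForm_smul] at h2
  rw [dualForm_add]
  simp only [neg_smul, one_smul, mul_neg, neg_mul, Matrix.trace_neg, Complex.neg_re] at h2
  rw [← sub_eq_add_neg] at h2
  linarith

/-- A positive semidefinite functional is bounded by the local norm. -/
lemma abs_trace_mul_re_le (hP : P.PosDef) (hU : U.IsHermitian) (hA : A.PosSemidef) :
    |(A * U).trace.re| ≤ Real.sqrt (dualForm P⁻¹ U) * (A * P).trace.re := by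
  obtain ⟨B, Y, hB, rfl, hY, rfl⟩ := exists_congruence hP hU
  have hA' := hA.mul_mul_conjTranspose_same B
  have e3 : (A * (Bᴴ * Y * B)).trace = (B * A * Bᴴ * Y).trace := by
    rw [← mul_assoc, Matrix.trace_mul_comm]; simp only [mul_assoc]
  have e4 : (A * (Bᴴ * B)).trace = (B * A * Bᴴ).trace := by
    rw [← mul_assoc, Matrix.trace_mul_comm, mul_assoc]
  rw [dualForm_congruence hB, e3, e4]
  -- After congruence this is Cauchy-Schwarz, together with the fact that the Hilbert-Schmidt norm
  -- of a positive semidefinite matrix is at most its trace.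
  have h1 := trace_mul_re_sq_le hA'.1 hY
  have h2 := trace_mul_self_re_le_sq hA'
  have h3 := trace_mul_self_re_nonneg hY
  have h4 : 0 ≤ (B * A * Bᴴ).trace.re := (Complex.le_def.mp hA'.trace_nonneg).1
  refine abs_le_of_sq_le_sq ?_ (by positivity)
  rw [mul_pow, Real.sq_sqrt h3]
  nlinarith

lemma dualForm_inv_mul_mul (hP : P.PosDef) : dualForm P⁻¹ (P * U * P) = dualForm P U := by
  have hd : IsUnit P.det := (Matrix.isUnit_iff_isUnit_det _).1 hP.isUnit
  rw [dualForm, dualForm, mul_assoc _ P, Matrix.mul_nonsing_inv _ hd, mul_one, mul_assoc _ _ P⁻¹,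
    mul_assoc _ P, Matrix.mul_nonsing_inv _ hd, mul_one, mul_assoc, Matrix.trace_mul_comm]
  simp only [mul_assoc]

lemma trace_mul_re_sq_le_dualForm (hP : P.PosDef) (hU : U.IsHermitian) (hV : V.IsHermitian) :
    (U * V).trace.re ^ 2 ≤ dualForm P U * dualForm P⁻¹ V := by
  obtain ⟨B, Y, hB, rfl, hY, rfl⟩ := exists_congruence hP hV
  have e3 : (U * (Bᴴ * Y * B)).trace = (B * U * Bᴴ * Y).trace := by
    rw [← mul_assoc, Matrix.trace_mul_comm]; simp only [mul_assoc]
  rw [dualForm_congruence hB, dualForm_factor, e3]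
  exact trace_mul_re_sq_le (Matrix.isHermitian_mul_mul_conjTranspose _ hU) hY

lemma toReal_logBarrier (hP : 0 < P.det.re) :
    (logBarrier P).toReal = -Real.log P.det.re - d * Real.log d := by
  rw [logBarrier, ENNReal.log_ofReal_of_pos hP, ← EReal.coe_neg, ← EReal.coe_sub, EReal.toReal_coe]

/-- Along the line through `P` in direction `U` the barrier is, up to a constant, `-∑ log (1 + s
lᵢ)` near `s = 0`, where `lᵢ` are the eigenvalues of `Y`. Its second derivative at `0` is `∑ lᵢ²`.
-/
lemma localNorm_eq (hP : P.PosDef) (hU : U.IsHermitian) :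
    localNorm P U = Real.sqrt (dualForm P⁻¹ U) := by
  obtain ⟨B, Y, hB, rfl, hY, rfl⟩ := exists_congruence hP hU
  rw [localNorm, dualForm_congruence hB, trace_mul_self_re_eq_sum hY]
  congr 1
  set l := hY.eigenvalues with hl
  have hcont : ∀ i, ∀ᶠ s : ℝ in nhds 0, 0 < 1 + s * l i := fun i => by
    have : ContinuousAt (fun s : ℝ => 1 + s * l i) 0 := by fun_prop
    exact this.eventually (lt_mem_nhds (by simp))
  have hpos : ∀ᶠ s : ℝ in nhds 0, ∀ i, 0 < 1 + s * l i := Filter.eventually_all.2 hcont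
  have e : ∀ᶠ s : ℝ in nhds 0, (logBarrier (Bᴴ * B + s • (Bᴴ * Y * B))).toReal =
      (-∑ i, Real.log (1 + s * l i)) + (-Real.log (Bᴴ * B).det.re - d * Real.log d) := by
    filter_upwards [hpos] with s hs
    have e3 : Bᴴ * B + s • (Bᴴ * Y * B) = Bᴴ * (1 + s • Y) * B := by simp [mul_add, add_mul]
    have e4 : (Bᴴ * B + s • (Bᴴ * Y * B)).det.re = (Bᴴ * B).det.re * ∏ i, (1 + s * l i) := by
      have h1 : (Bᴴ * B + s • (Bᴴ * Y * B)).det = (Bᴴ * B).det * (1 + s • Y).det := by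
        rw [e3]; simp only [Matrix.det_mul]; ring
      rw [h1, det_one_add_smul hY s, Complex.re_mul_ofReal]
    have h5 : 0 < ∏ i, (1 + s * l i) := Finset.prod_pos fun i _ => hs i
    rw [toReal_logBarrier (by rw [e4]; exact mul_pos (det_pos_re hP) h5), e4,
      Real.log_mul (det_pos_re hP).ne' h5.ne', Real.log_prod fun i _ => (hs i).ne']
    ring
  rw [Filter.EventuallyEq.iteratedDeriv_eq 2 e, iteratedDeriv_succ, iteratedDeriv_one]
  have hd1 : ∀ᶠ s : ℝ in nhds 0, deriv (fun s : ℝ => (-∑ i, Real.log (1 + s * l i)) +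
      (-Real.log (Bᴴ * B).det.re - d * Real.log d)) s = -∑ i, l i / (1 + s * l i) := by
    filter_upwards [hpos] with s hs
    refine HasDerivAt.deriv (HasDerivAt.add_const _ (HasDerivAt.neg
      (HasDerivAt.fun_sum fun i _ => ?_)))
    exact HasDerivAt.log (by simpa using ((hasDerivAt_id s).mul_const (l i)).const_add 1) (hs i).ne'
  rw [Filter.EventuallyEq.deriv_eq hd1]
  have hd2 : HasDerivAt (fun s : ℝ => -∑ i, l i / (1 + s * l i)) (-∑ i, -(l i ^ 2)) 0 := by
    refine HasDerivAt.neg (HasDerivAt.fun_sum fun i _ => ?_)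
    have h1 : HasDerivAt (fun s : ℝ => 1 + s * l i) (l i) 0 := by
      simpa using ((hasDerivAt_id (0 : ℝ)).mul_const (l i)).const_add 1
    have := (hasDerivAt_const (0 : ℝ) (l i)).fun_div h1 (by simp)
    simpa [pow_two] using this
  rw [hd2.deriv]
  simp

lemma dualLocalNorm_eq (hP : P.PosDef) (hU : U.IsHermitian) :
    dualLocalNorm P U = Real.sqrt (dualForm P U) := by
  have hN := dualForm_nonneg hP hU
  refine IsGreatest.csSup_eq ⟨?_, ?_⟩
  · have hT : (P * U * P).IsHermitian := by
      have := Matrix.isHermitian_mul_mul_conjTranspose P hU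
      rwa [hP.1.eq] at this
    have hT' : ((Real.sqrt (dualForm P U))⁻¹ • (P * U * P)).IsHermitian := by
      unfold Matrix.IsHermitian; rw [Matrix.conjTranspose_smul, hT.eq]; simp
    -- The maximizer is the normalized `P * U * P`. If the form vanishes, the inverse is `0` by
    -- convention and the zero matrix serves as `T`.
    refine ⟨(Real.sqrt (dualForm P U))⁻¹ • (P * U * P), hT', ?_, ?_⟩
    · rw [localNorm_eq hP hT', Real.sqrt_le_one, dualForm_smul, dualForm_inv_mul_mul hP, inv_pow,
        Real.sq_sqrt hN]
      exact inv_mul_le_one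
    · have : (U * (P * U * P)).trace.re = dualForm P U := by simp only [dualForm, mul_assoc]
      rw [Matrix.mul_smul, Matrix.trace_smul, Complex.real_smul, Complex.re_ofReal_mul, this,
        abs_of_nonneg (by positivity)]
      rcases hN.eq_or_lt with h | h
      · simp [← h]
      · have h2 := Real.sqrt_pos.2 h
        field_simp
        rw [Real.sq_sqrt hN]
  · rintro r ⟨T, hT, h1, rfl⟩
    rw [localNorm_eq hP hT, Real.sqrt_le_one] at h1
    refine Real.abs_le_sqrt ((trace_mul_re_sq_le_dualForm hP hU hT).trans ?_)
    nlinarith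

lemma dualLocalNorm_sq (hP : P.PosDef) (hU : U.IsHermitian) :
    dualLocalNorm P U ^ 2 = dualForm P U := by
  rw [dualLocalNorm_eq hP hU, Real.sq_sqrt (dualForm_nonneg hP hU)]

lemma isHermitian_add_smul_one (hU : U.IsHermitian) (c : ℝ) :
    (U + c • (1 : Matrix (Fin d) (Fin d) ℂ)).IsHermitian :=
  hU.add (by unfold Matrix.IsHermitian; rw [Matrix.conjTranspose_smul]; simp)

lemma trace_mul_alphaShift (hd : 0 < d) (hP : P.PosDef) :
    ((U + alphaShift P U • (1 : Matrix (Fin d) (Fin d) ℂ)) * P * P).trace.re = 0 := by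
  have : Nonempty (Fin d) := ⟨⟨0, hd⟩⟩
  have h2 : 0 < (P * P).trace.re := by
    rw [trace_mul_self_re_eq_sum hP.1]
    exact Finset.sum_pos (fun i _ => pow_pos (hP.eigenvalues_pos i) 2) Finset.univ_nonempty
  have h3 : (P * U * P).trace = (U * P * P).trace := by
    rw [Matrix.trace_mul_comm, ← mul_assoc, Matrix.trace_mul_comm, mul_assoc]
  rw [alphaShift, h3]
  simp only [add_mul, Matrix.trace_add, Matrix.smul_mul, Matrix.trace_smul, Complex.add_re,
    Complex.real_smul, Complex.re_ofReal_mul, one_mul]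
  field_simp
  ring

/-- By `trace_mul_alphaShift`, the shifted matrix is orthogonal to the identity for the form at `P`,
so this is Pythagoras. The case `c = 0` compares with the unshifted norm. -/
lemma dualForm_alphaShift_le (hd : 0 < d) (hP : P.PosDef) (c : ℝ) :
    dualForm P (U + alphaShift P U • (1 : Matrix (Fin d) (Fin d) ℂ)) ≤
      dualForm P (U + c • (1 : Matrix (Fin d) (Fin d) ℂ)) := by
  have h1 := trace_mul_alphaShift (U := U) hd hP
  generalize alphaShift P U = α at *
  have h2 : U + c • (1 : Matrix (Fin d) (Fin d) ℂ) =
      (U + α • (1 : Matrix (Fin d) (Fin d) ℂ)) + (c - α) • (1 : Matrix (Fin d) (Fin d) ℂ) := by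
    rw [sub_smul]; abel
  rw [h2, dualForm_add (V := (c - α) • (1 : Matrix (Fin d) (Fin d) ℂ)), Matrix.mul_smul,
    Matrix.smul_mul, mul_one, Matrix.trace_smul, Complex.real_smul, Complex.re_ofReal_mul, h1,
    dualForm_smul]
  have := dualForm_nonneg hP (U := 1) Matrix.isHermitian_one
  nlinarith [mul_nonneg (sq_nonneg (c - α)) this]

end Congruence

/-! ### The logarithmic barrier on density matrices. -/

section Barrier

variable {d : ℕ} {P U σ ρ : Matrix (Fin d) (Fin d) ℂ}

/-- The logarithmic barrier as a real function, equal to `logBarrier` at positive definite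
matrices. -/
noncomputable def realBarrier (ρ : Matrix (Fin d) (Fin d) ℂ) : ℝ :=
  -Real.log ρ.det.re - d * Real.log d

lemma logBarrier_eq (hP : P.PosDef) : logBarrier P = (realBarrier P : EReal) := by
  rw [logBarrier, realBarrier, ENNReal.log_ofReal_of_pos (det_pos_re hP), ← EReal.coe_neg,
    ← EReal.coe_sub]

lemma posDef_of_logBarrier_ne_top (hP : P.PosSemidef) (h : logBarrier P ≠ ⊤) : P.PosDef := by
  rw [hP.posDef_iff_det_ne_zero]
  intro h0
  apply h
  rw [logBarrier, h0]
  simp only [Complex.zero_re, ENNReal.ofReal_zero, ENNReal.log_zero, EReal.neg_bot]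
  exact EReal.top_sub_coe _

lemma posDef_smul_one {c : ℝ} (hc : 0 < c) :
    (c • (1 : Matrix (Fin d) (Fin d) ℂ)).PosDef :=
  Matrix.PosDef.one.smul hc

lemma det_smul_one_re (c : ℝ) : (c • (1 : Matrix (Fin d) (Fin d) ℂ)).det.re = c ^ d := by
  rw [← Complex.coe_smul, Matrix.det_smul]
  simp [← Complex.ofReal_pow]

lemma trace_re_eq_one (h : ρ ∈ densityMatrices d) : ρ.trace.re = 1 := by
  rw [h.2]; rfl

lemma smul_one_mem_densityMatrices (hd : 0 < d) :
    (d : ℝ)⁻¹ • (1 : Matrix (Fin d) (Fin d) ℂ) ∈ densityMatrices d := by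
  have hd' : (0 : ℝ) < d := Nat.cast_pos.2 hd
  refine ⟨(posDef_smul_one (by positivity)).posSemidef, ?_⟩
  rw [Matrix.trace_smul, Matrix.trace_one, Complex.real_smul]
  simp [hd.ne']

/-- The Fenchel inequality against `d • 1`, whose right side vanishes at unit trace: the maximally
mixed state minimizes the barrier. -/
lemma realBarrier_nonneg (hd : 0 < d) (hP : P.PosDef) (h : P ∈ densityMatrices d) :
    0 ≤ realBarrier P := by
  have hd' : (0 : ℝ) < d := Nat.cast_pos.2 hd
  have h1 := log_det_add_log_det_le hP (posDef_smul_one hd')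
  rw [det_smul_one_re, Real.log_pow, Matrix.mul_smul, mul_one, Matrix.trace_smul,
    Complex.real_smul, Complex.re_ofReal_mul, trace_re_eq_one h] at h1
  rw [realBarrier]
  linarith

lemma realBarrier_inv_smul_one :
    realBarrier ((d : ℝ)⁻¹ • (1 : Matrix (Fin d) (Fin d) ℂ)) = 0 := by
  rw [realBarrier, det_smul_one_re, Real.log_pow, Real.log_inv]
  ring

/-- The barrier of a mixture with the maximally mixed state. -/
lemma realBarrier_add_smul_one_le (hd : 0 < d) (hU : U.PosSemidef) {c : ℝ} (hc : 0 < c) :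
    realBarrier (U + (c / d) • (1 : Matrix (Fin d) (Fin d) ℂ)) ≤ -d * Real.log c := by
  have hd' : (0 : ℝ) < d := Nat.cast_pos.2 hd
  have h1 := posDef_smul_one (d := d) (div_pos hc hd')
  have h2 := h1.posSemidef_add hU
  have hu : IsUnit (U + (c / d) • (1 : Matrix (Fin d) (Fin d) ℂ)).det :=
    (Matrix.isUnit_iff_isUnit_det _).1 h2.isUnit
  -- For `M = U + (c/d) I`, the Fenchel inequality at `(c/d) I` and `M⁻¹` bounds `log det M` below
  -- by `d log (c/d)`, because `tr((c/d) M⁻¹) = d - tr(U M⁻¹) ≤ d`.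
  have h3 := log_det_add_log_det_le h1 h2.inv
  have h4 : ((c / d) • (1 : Matrix (Fin d) (Fin d) ℂ)) *
      (U + (c / d) • (1 : Matrix (Fin d) (Fin d) ℂ))⁻¹ =
      1 - U * (U + (c / d) • (1 : Matrix (Fin d) (Fin d) ℂ))⁻¹ := by
    rw [eq_sub_iff_add_eq, ← add_mul, add_comm _ U, Matrix.mul_nonsing_inv _ hu]
  have h5 := trace_mul_re_nonneg hU h2.inv.posSemidef
  have h6 : (U + (c / d) • (1 : Matrix (Fin d) (Fin d) ℂ))⁻¹.det.re =
      (U + (c / d) • (1 : Matrix (Fin d) (Fin d) ℂ)).det.re⁻¹ := by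
    rw [Matrix.det_nonsing_inv, Ring.inverse_eq_inv', det_eq_re h2.posSemidef, ← Complex.ofReal_inv]
    simp
  rw [h4, Matrix.trace_sub, Complex.sub_re, Matrix.trace_one, h6, Real.log_inv,
    det_smul_one_re, Real.log_pow, Real.log_div hc.ne' hd'.ne'] at h3
  simp only [Fintype.card_fin, Complex.natCast_re] at h3
  rw [realBarrier]
  nlinarith

/-- The one-step inequality of dual averaging. -/
lemma realBarrier_step (hρ : ρ.PosDef) (hσ : σ.PosDef) (hU : U.IsHermitian)
    (h : dualForm ρ U ≤ 1 / 4) :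
    realBarrier ρ + (ρ⁻¹ * ρ).trace.re + (U * ρ).trace.re ≤
      realBarrier σ + (ρ⁻¹ * σ).trace.re + (U * σ).trace.re + dualForm ρ U := by
  have hdet : IsUnit ρ.det := (Matrix.isUnit_iff_isUnit_det _).1 hρ.isUnit
  have e0 : ρ⁻¹⁻¹ = ρ := Matrix.nonsing_inv_nonsing_inv _ hdet
  -- The quadratic bound is applied to the inverse: `h` plus the linear functional `ρ⁻¹ + U` is
  -- bounded below through `log det (ρ⁻¹ + U)`, which is then expanded around `ρ⁻¹`.
  obtain ⟨h1, h2⟩ := posDef_add_and_log_det_ge hρ.inv hU (by rwa [e0])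
  rw [e0] at h2
  have h3 := log_det_add_log_det_le hσ h1
  have h6 : ρ⁻¹.det.re = ρ.det.re⁻¹ := by
    rw [Matrix.det_nonsing_inv, Ring.inverse_eq_inv', det_eq_re hρ.posSemidef, ← Complex.ofReal_inv]
    simp
  rw [h6, Real.log_inv] at h2
  rw [mul_add, Matrix.trace_add, Complex.add_re, Matrix.trace_mul_comm σ,
    Matrix.trace_mul_comm σ] at h3
  rw [Matrix.nonsing_inv_mul _ hdet, Matrix.trace_one, realBarrier, realBarrier]
  simp only [Fintype.card_fin, Complex.natCast_re]
  linarith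

/-- The first-order optimality condition of a minimizer of a linear function plus the barrier. -/
lemma trace_inv_mul_le_of_isMin (hρ : ρ.PosDef) (hσ : σ.IsHermitian) {Θ : Matrix (Fin d) (Fin d) ℂ}
    (h : ∀ s ∈ Set.Ioc (0 : ℝ) 1, (ρ + s • (σ - ρ)).PosDef →
      (Θ * ρ).trace.re + realBarrier ρ ≤
        (Θ * (ρ + s • (σ - ρ))).trace.re + realBarrier (ρ + s • (σ - ρ))) :
    (ρ⁻¹ * σ).trace.re + (Θ * ρ).trace.re ≤ (ρ⁻¹ * ρ).trace.re + (Θ * σ).trace.re := by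
  set X := σ - ρ with hXdef
  have hX : X.IsHermitian := hσ.sub hρ.1
  set N := dualForm ρ⁻¹ X with hN
  have hN0 : 0 ≤ N := dualForm_nonneg hρ.inv hX
  have key : ∀ s : ℝ, 0 < s → s ≤ 1 → s ^ 2 * N ≤ 1 / 4 →
      0 ≤ (Θ * X).trace.re - (X * ρ⁻¹).trace.re + s * N := by
    intro s hs hs1 hsN
    have hsX : (s • X).IsHermitian := by
      unfold Matrix.IsHermitian; rw [Matrix.conjTranspose_smul, hX.eq]; simp
    obtain ⟨h1, h2⟩ := posDef_add_and_log_det_ge hρ hsX (by rwa [dualForm_smul])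
    have h3 := h s ⟨hs, hs1⟩ h1
    rw [dualForm_smul] at h2
    rw [realBarrier, realBarrier, mul_add, Matrix.trace_add, Complex.add_re] at h3
    simp only [Matrix.mul_smul, Matrix.smul_mul, Matrix.trace_smul, Complex.real_smul,
      Complex.re_ofReal_mul] at h2 h3
    have h4 : 0 ≤ s * ((Θ * X).trace.re - (X * ρ⁻¹).trace.re + s * N) := by
      rw [← hN] at h2
      nlinarith
    exact nonneg_of_mul_nonneg_right h4 hs
  have h0 : 0 ≤ (Θ * X).trace.re - (X * ρ⁻¹).trace.re := by
    by_contra! hneg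
    set a := (X * ρ⁻¹).trace.re - (Θ * X).trace.re with ha
    have ha0 : 0 < a := by linarith
    -- The first entry keeps the step inside the Dikin ellipsoid. The second makes the quadratic
    -- error `s * N` at most `a / 2`, so a negative directional derivative `-a` contradicts
    -- minimality.
    have hs : 0 < min (1 / (2 * (N + 1))) (a / (2 * (N + 1))) := by positivity
    have hb1 := min_le_left (1 / (2 * (N + 1))) (a / (2 * (N + 1)))
    have hb2 := min_le_right (1 / (2 * (N + 1))) (a / (2 * (N + 1)))
    set s := min (1 / (2 * (N + 1))) (a / (2 * (N + 1)))
    rw [le_div_iff₀ (by positivity)] at hb1 hb2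
    have := key s hs (by nlinarith) (by nlinarith [mul_nonneg hs.le hN0])
    nlinarith [mul_nonneg hs.le hN0]
  rw [hXdef, mul_sub, sub_mul, Matrix.trace_sub, Matrix.trace_sub, Complex.sub_re, Complex.sub_re,
    Matrix.trace_mul_comm σ, Matrix.trace_mul_comm ρ] at h0
  linarith

end Barrier

/-! ### Regret of dual averaging with the adaptive learning rate. -/

section Regret

variable {d : ℕ} {G : ℝ} {g ρ : ℕ → Matrix (Fin d) (Fin d) ℂ}

lemma smul_add_smul_mem_densityMatrices {P Q : Matrix (Fin d) (Fin d) ℂ}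
    (hP : P ∈ densityMatrices d) (hQ : Q ∈ densityMatrices d) {a b : ℝ} (ha : 0 ≤ a) (hb : 0 ≤ b)
    (hab : a + b = 1) : a • P + b • Q ∈ densityMatrices d := by
  refine ⟨(hP.1.smul ha).add (hQ.1.smul hb), ?_⟩
  rw [Matrix.trace_add, Matrix.trace_smul, Matrix.trace_smul, hP.2, hQ.2, ← add_smul, hab, one_smul]

/-- The squared dual local norm of the gradient estimate shifted by a multiple of the identity. -/
noncomputable def shiftedNormSq (g ρ : ℕ → Matrix (Fin d) (Fin d) ℂ) (t : ℕ) : ℝ :=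
  dualForm (ρ t) (g t + alphaShift (ρ t) (g t) • (1 : Matrix (Fin d) (Fin d) ℂ))

/-- The objective is finite at `I/d`, hence at its minimizer, and the barrier is infinite at
singular matrices. Indexing by `t + 1` includes the initial iterate. -/
lemma IsDualAveraging.mem_and_posDef (hd : 0 < d) (h : IsDualAveraging G g ρ) :
    ∀ t, ρ (t + 1) ∈ densityMatrices d ∧ (ρ (t + 1)).PosDef
  | 0 => by
    have hd' : (0 : ℝ) < d := Nat.cast_pos.2 hd
    rw [zero_add, h.init]
    exact ⟨smul_one_mem_densityMatrices hd, posDef_smul_one (by positivity)⟩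
  | t + 1 => by
    have hd' : (0 : ℝ) < d := Nat.cast_pos.2 hd
    have hm := h.mem (t + 1) (by omega)
    refine ⟨hm, posDef_of_logBarrier_ne_top hm.1 fun htop => ?_⟩
    have h1 := isMinOn_iff.1 (h.isMinOn (t + 1) (by omega)) _ (smul_one_mem_densityMatrices hd)
    rw [htop, logBarrier_eq (posDef_smul_one (by positivity)), ← EReal.coe_add,
      EReal.coe_add_top, top_le_iff] at h1
    exact EReal.coe_ne_top _ h1

/-- The minimality condition in real form. It also holds at `t = 0`, where the sum is empty and
`I/d` minimizes the barrier, so the regret recursion can start there. -/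
lemma IsDualAveraging.realBarrier_add_le (hd : 0 < d) (h : IsDualAveraging G g ρ) (t : ℕ)
    {σ : Matrix (Fin d) (Fin d) ℂ} (hσ : σ.PosDef) (hσ' : σ ∈ densityMatrices d) :
    ((learningRate G g ρ t • ∑ τ ∈ Finset.Icc 1 t, g τ) * ρ (t + 1)).trace.re +
        realBarrier (ρ (t + 1)) ≤
      ((learningRate G g ρ t • ∑ τ ∈ Finset.Icc 1 t, g τ) * σ).trace.re + realBarrier σ := by
  rcases Nat.eq_zero_or_pos t with rfl | ht
  · rw [zero_add, h.init, realBarrier_inv_smul_one]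
    simpa using realBarrier_nonneg hd hσ hσ'
  · have h1 := isMinOn_iff.1 (h.isMinOn t ht) _ hσ'
    rw [logBarrier_eq hσ, logBarrier_eq (h.mem_and_posDef hd t).2, ← EReal.coe_add,
      ← EReal.coe_add, EReal.coe_le_coe_iff] at h1
    simpa only [Matrix.smul_mul, Matrix.trace_smul, Complex.real_smul, Complex.re_ofReal_mul,
      Finset.sum_mul, Matrix.trace_sum, Complex.re_sum] using h1

lemma isHermitian_smul {U : Matrix (Fin d) (Fin d) ℂ} (hU : U.IsHermitian) (c : ℝ) :
    (c • U).IsHermitian := by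
  unfold Matrix.IsHermitian; rw [Matrix.conjTranspose_smul, hU.eq]; simp

lemma learningRate_eq (hd : 0 < d) (h : IsDualAveraging G g ρ)
    (hg : ∀ t, 1 ≤ t → (g t).IsHermitian) (t : ℕ) :
    learningRate G g ρ t = Real.sqrt d /
      Real.sqrt ((∑ τ ∈ Finset.Icc 1 t, shiftedNormSq g ρ τ) + 4 * d * G ^ 2 + G ^ 2) := by
  rw [learningRate, Finset.sum_congr rfl fun τ hτ => ?_]
  obtain ⟨k, rfl⟩ := Nat.exists_eq_add_of_le' (Finset.mem_Icc.1 hτ).1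
  exact dualLocalNorm_sq (h.mem_and_posDef hd k).2 (isHermitian_add_smul_one (hg _ (by omega)) _)

lemma shiftedNormSq_nonneg (hd : 0 < d) (h : IsDualAveraging G g ρ)
    (hg : ∀ t, 1 ≤ t → (g t).IsHermitian) {t : ℕ} (ht : 1 ≤ t) : 0 ≤ shiftedNormSq g ρ t := by
  obtain ⟨k, rfl⟩ := Nat.exists_eq_add_of_le' ht
  exact dualForm_nonneg (h.mem_and_posDef hd k).2 (isHermitian_add_smul_one (hg _ ht) _)

lemma shiftedNormSq_le (hd : 0 < d) (h : IsDualAveraging G g ρ)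
    (hg : ∀ t, 1 ≤ t → (g t).IsHermitian) {t : ℕ} (ht : 1 ≤ t)
    (hG : dualLocalNorm (ρ t) (g t) ≤ G) : shiftedNormSq g ρ t ≤ G ^ 2 := by
  obtain ⟨k, rfl⟩ := Nat.exists_eq_add_of_le' ht
  have hp := (h.mem_and_posDef hd k).2
  have h1 := dualForm_alphaShift_le (U := g (k + 1)) hd hp 0
  rw [zero_smul, add_zero, ← dualLocalNorm_sq hp (hg _ ht)] at h1
  refine h1.trans (pow_le_pow_left₀ ?_ hG 2)
  rw [dualLocalNorm_eq hp (hg _ ht)]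
  positivity

lemma IsDualAveraging.step (hd : 0 < d) (h : IsDualAveraging G g ρ)
    (hg : ∀ t, 1 ≤ t → (g t).IsHermitian) (t : ℕ) {σ : Matrix (Fin d) (Fin d) ℂ}
    (hσ : σ.PosDef) (hσ' : σ ∈ densityMatrices d)
    (hη : learningRate G g ρ t ^ 2 * shiftedNormSq g ρ (t + 1) ≤ 1 / 4) :
    realBarrier (ρ (t + 1)) + learningRate G g ρ t *
        (((∑ τ ∈ Finset.Icc 1 t, g τ) * ρ (t + 1)).trace.re + (g (t + 1) * ρ (t + 1)).trace.re) ≤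
      realBarrier σ + learningRate G g ρ t * ((∑ τ ∈ Finset.Icc 1 (t + 1), g τ) * σ).trace.re +
        learningRate G g ρ t ^ 2 * shiftedNormSq g ρ (t + 1) := by
  obtain ⟨hm, hp⟩ := h.mem_and_posDef hd t
  set η := learningRate G g ρ t
  have h1 := trace_inv_mul_le_of_isMin hp hσ.1 (Θ := η • ∑ τ ∈ Finset.Icc 1 t, g τ)
    fun s hs hpd => h.realBarrier_add_le hd t hpd (by
      have := smul_add_smul_mem_densityMatrices hm hσ' (a := 1 - s) (b := s)
        (by linarith [hs.2]) hs.1.le (by ring)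
      convert this using 1
      rw [smul_sub, sub_smul, one_smul]; abel)
  -- Adding a multiple of the identity changes both sides by the same constant at unit trace, while
  -- the shift `alphaShift` makes the quadratic error smallest.
  have hU := isHermitian_add_smul_one (hg (t + 1) (by omega))
    (alphaShift (ρ (t + 1)) (g (t + 1)))
  have h2 := realBarrier_step hp hσ (isHermitian_smul hU η) (by
    rw [dualForm_smul]; exact hη)
  rw [dualForm_smul] at h2
  rw [Finset.sum_Icc_succ_top (by omega)]
  simp only [Matrix.smul_mul, Matrix.trace_smul, Complex.real_smul, Complex.re_ofReal_mul,
    add_mul, Matrix.trace_add, Complex.add_re, one_mul, trace_re_eq_one hm,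
    trace_re_eq_one hσ'] at h1 h2 ⊢
  rw [shiftedNormSq]
  linarith

lemma div_sqrt_add_le {S a : ℝ} (hS : 0 ≤ S) (ha : 0 ≤ a) :
    a / Real.sqrt (S + a) ≤ 2 * (Real.sqrt (S + a) - Real.sqrt S) := by
  rcases (add_nonneg hS ha).eq_or_lt with h | h
  · have h1 : a = 0 := by linarith
    simp [h1]
  · have h1 := Real.sqrt_pos.2 h
    have h2 := Real.sqrt_le_sqrt (show S ≤ S + a by linarith)
    rw [div_le_iff₀ h1]
    nlinarith [Real.sq_sqrt hS, Real.sq_sqrt h.le, sq_nonneg (Real.sqrt (S + a) - Real.sqrt S)]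

/-- The accumulated squared norms in the learning rate, without the last term `G²`. -/
noncomputable def normSqSum (G : ℝ) (g ρ : ℕ → Matrix (Fin d) (Fin d) ℂ) (t : ℕ) : ℝ :=
  (∑ τ ∈ Finset.Icc 1 t, shiftedNormSq g ρ τ) + 4 * d * G ^ 2

lemma normSqSum_succ (t : ℕ) :
    normSqSum G g ρ (t + 1) = normSqSum G g ρ t + shiftedNormSq g ρ (t + 1) := by
  rw [normSqSum, normSqSum, Finset.sum_Icc_succ_top (by omega)]
  ring

lemma le_normSqSum (hd : 0 < d) (h : IsDualAveraging G g ρ)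
    (hg : ∀ t, 1 ≤ t → (g t).IsHermitian) (t : ℕ) : 4 * d * G ^ 2 ≤ normSqSum G g ρ t := by
  have : 0 ≤ ∑ τ ∈ Finset.Icc 1 t, shiftedNormSq g ρ τ :=
    Finset.sum_nonneg fun τ hτ => shiftedNormSq_nonneg hd h hg (Finset.mem_Icc.1 hτ).1
  rw [normSqSum]
  linarith

lemma learningRate_eq' (hd : 0 < d) (h : IsDualAveraging G g ρ)
    (hg : ∀ t, 1 ≤ t → (g t).IsHermitian) (t : ℕ) :
    learningRate G g ρ t = Real.sqrt d / Real.sqrt (normSqSum G g ρ t + G ^ 2) :=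
  learningRate_eq hd h hg t

lemma mul_inv_add_le_of_add_mul_le {η a b c e : ℝ} (hη : 0 < η) (h : a + η * b ≤ c + η * e) :
    a * η⁻¹ + b ≤ c * η⁻¹ + e := by
  rw [← mul_le_mul_iff_of_pos_left hη]
  field_simp
  linarith

lemma normSqSum_add_pos (hd : 0 < d) (h : IsDualAveraging G g ρ) (hG : 0 < G)
    (hg : ∀ t, 1 ≤ t → (g t).IsHermitian)
    (t : ℕ) : 0 < normSqSum G g ρ t + G ^ 2 := by
  have := le_normSqSum hd h hg t
  have h2 : 0 ≤ 4 * d * G ^ 2 := by positivity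
  have h3 : 0 < G ^ 2 := by positivity
  linarith

lemma learningRate_pos (hd : 0 < d) (h : IsDualAveraging G g ρ) (hG : 0 < G)
    (hg : ∀ t, 1 ≤ t → (g t).IsHermitian)
    (t : ℕ) : 0 < learningRate G g ρ t := by
  rw [learningRate_eq' hd h hg]
  have := Real.sqrt_pos.2 (normSqSum_add_pos hd h hG hg t)
  have hd' : (0 : ℝ) < d := Nat.cast_pos.2 hd
  positivity

lemma learningRate_inv_le_succ (hd : 0 < d) (h : IsDualAveraging G g ρ)
    (hg : ∀ t, 1 ≤ t → (g t).IsHermitian)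
    (t : ℕ) :
    (learningRate G g ρ t)⁻¹ ≤ (learningRate G g ρ (t + 1))⁻¹ := by
  rw [learningRate_eq' hd h hg, learningRate_eq' hd h hg, inv_div, inv_div, normSqSum_succ]
  have := shiftedNormSq_nonneg hd h hg (t := t + 1) (by omega)
  gcongr
  linarith

/-- This is what the term `4dG²` in the learning rate is for: the shifted norm squared is at most
`G²`, so the scaled gradient stays within the radius required by `realBarrier_step`. -/
lemma learningRate_sq_mul_le (hd : 0 < d) (h : IsDualAveraging G g ρ) (hG : 0 < G)
    (hg : ∀ t, 1 ≤ t → (g t).IsHermitian)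
    (hgG : ∀ t, 1 ≤ t → dualLocalNorm (ρ t) (g t) ≤ G)
    (t : ℕ) :
    learningRate G g ρ t ^ 2 * shiftedNormSq g ρ (t + 1) ≤ 1 / 4 := by
  have hZ := normSqSum_add_pos hd h hG hg t
  have hd' : (0 : ℝ) < d := Nat.cast_pos.2 hd
  rw [learningRate_eq' hd h hg, div_pow, Real.sq_sqrt hd'.le, Real.sq_sqrt hZ.le,
    div_mul_eq_mul_div, div_le_iff₀ hZ]
  have h1 := le_normSqSum hd h hg t
  have h2 := mul_le_mul_of_nonneg_left
    (shiftedNormSq_le hd h hg (t := t + 1) (by omega) (hgG _ (by omega))) hd'.le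
  have h3 := sq_nonneg G
  linarith

/-- The rate at time `t` has not yet seen the gradient `t + 1`. The surplus `G²` in its denominator
dominates that missing term, so the errors telescope through `div_sqrt_add_le`. -/
lemma learningRate_mul_le (hd : 0 < d) (h : IsDualAveraging G g ρ) (hG : 0 < G)
    (hg : ∀ t, 1 ≤ t → (g t).IsHermitian)
    (hgG : ∀ t, 1 ≤ t → dualLocalNorm (ρ t) (g t) ≤ G)
    (t : ℕ) : learningRate G g ρ t * shiftedNormSq g ρ (t + 1) ≤
    Real.sqrt d * (2 * (Real.sqrt (normSqSum G g ρ (t + 1)) - Real.sqrt (normSqSum G g ρ t))) := by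
  have ha := shiftedNormSq_nonneg hd h hg (t := t + 1) (by omega)
  have hS : 0 ≤ normSqSum G g ρ t := le_trans (by positivity) (le_normSqSum hd h hg t)
  rw [normSqSum_succ]
  refine le_trans ?_ (mul_le_mul_of_nonneg_left (div_sqrt_add_le hS ha) (Real.sqrt_nonneg _))
  rw [learningRate_eq' hd h hg, div_mul_eq_mul_div, mul_div_assoc]
  refine mul_le_mul_of_nonneg_left ?_ (Real.sqrt_nonneg _)
  rcases ha.eq_or_lt with h0 | h0
  · simp [← h0]
  · refine div_le_div_of_nonneg_left ha (Real.sqrt_pos.2 (by linarith)) (Real.sqrt_le_sqrt ?_)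
    have := shiftedNormSq_le hd h hg (t := t + 1) (by omega) (hgG _ (by omega))
    linarith

/-- The one-step inequality divided by the learning rate, so that the linear terms no longer carry a
time-dependent factor and can be summed. -/
lemma potential_le (hd : 0 < d) (h : IsDualAveraging G g ρ) (hG : 0 < G)
    (hg : ∀ t, 1 ≤ t → (g t).IsHermitian)
    (hgG : ∀ t, 1 ≤ t → dualLocalNorm (ρ t) (g t) ≤ G)
    (t : ℕ) {σ : Matrix (Fin d) (Fin d) ℂ} (hσ : σ.PosDef)
    (hσ' : σ ∈ densityMatrices d) :
    realBarrier (ρ (t + 1)) * (learningRate G g ρ t)⁻¹ +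
        ((∑ τ ∈ Finset.Icc 1 t, g τ) * ρ (t + 1)).trace.re + (g (t + 1) * ρ (t + 1)).trace.re ≤
      realBarrier σ * (learningRate G g ρ t)⁻¹ +
        ((∑ τ ∈ Finset.Icc 1 (t + 1), g τ) * σ).trace.re +
        learningRate G g ρ t * shiftedNormSq g ρ (t + 1) := by
  have h1 := h.step hd hg t hσ hσ' (learningRate_sq_mul_le hd h hG hg hgG t)
  have h3 := learningRate_pos hd h hG hg t
  have h4 := mul_inv_add_le_of_add_mul_le h3
    (e := ((∑ τ ∈ Finset.Icc 1 (t + 1), g τ) * σ).trace.re +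
      learningRate G g ρ t * shiftedNormSq g ρ (t + 1)) (h1.trans_eq (by ring))
  linarith

lemma sum_trace_le_potential (hd : 0 < d) (h : IsDualAveraging G g ρ) (hG : 0 < G)
    (hg : ∀ t, 1 ≤ t → (g t).IsHermitian)
    (hgG : ∀ t, 1 ≤ t → dualLocalNorm (ρ t) (g t) ≤ G)
    (T : ℕ) : ∑ τ ∈ Finset.Icc 1 T, (g τ * ρ τ).trace.re ≤
    realBarrier (ρ (T + 1)) * (learningRate G g ρ T)⁻¹ +
      ((∑ τ ∈ Finset.Icc 1 T, g τ) * ρ (T + 1)).trace.re +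
      2 * Real.sqrt d * Real.sqrt (normSqSum G g ρ T) := by
  induction T with
  | zero =>
    rw [zero_add, h.init, realBarrier_inv_smul_one]
    simp only [zero_lt_one, Finset.Icc_eq_empty_of_lt, Finset.sum_empty, zero_mul,
      Matrix.trace_zero, Complex.zero_re, zero_add]
    positivity
  | succ t ih =>
    obtain ⟨hm, hp⟩ := h.mem_and_posDef hd (t + 1)
    -- The comparator is the next iterate. Since the barrier is nonnegative, the inverse rate may
    -- then be replaced by the next, larger one, and the induction closes.
    have h1 := potential_le hd h hG hg hgG t hp hm
    have h2 := mul_le_mul_of_nonneg_left (learningRate_inv_le_succ hd h hg t)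
      (realBarrier_nonneg hd hp hm)
    have h3 := learningRate_mul_le hd h hG hg hgG t
    rw [Finset.sum_Icc_succ_top (by omega)]
    linarith

/-- The regret bound of dual averaging with the logarithmic barrier. -/
theorem regret_le (hd : 0 < d) (h : IsDualAveraging G g ρ) (hG : 0 < G)
    (hg : ∀ t, 1 ≤ t → (g t).IsHermitian)
    (hgG : ∀ t, 1 ≤ t → dualLocalNorm (ρ t) (g t) ≤ G)
    (T : ℕ) {σ : Matrix (Fin d) (Fin d) ℂ} (hσ : σ.PosDef)
    (hσ' : σ ∈ densityMatrices d) {K : ℝ} (hK : realBarrier σ ≤ d * K) :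
    ∑ τ ∈ Finset.Icc 1 T, (g τ * (ρ τ - σ)).trace.re ≤
      Real.sqrt d * (K + 2) * Real.sqrt (normSqSum G g ρ T + G ^ 2) := by
  have hd' : (0 : ℝ) < d := Nat.cast_pos.2 hd
  have h1 := sum_trace_le_potential hd h hG hg hgG T
  have h2 := h.realBarrier_add_le hd T hσ hσ'
  rw [Matrix.smul_mul, Matrix.smul_mul, Matrix.trace_smul, Matrix.trace_smul, Complex.real_smul,
    Complex.real_smul, Complex.re_ofReal_mul, Complex.re_ofReal_mul] at h2
  have h3 : realBarrier (ρ (T + 1)) * (learningRate G g ρ T)⁻¹ +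
        ((∑ τ ∈ Finset.Icc 1 T, g τ) * ρ (T + 1)).trace.re ≤
        realBarrier σ * (learningRate G g ρ T)⁻¹ +
        ((∑ τ ∈ Finset.Icc 1 T, g τ) * σ).trace.re := by
    exact mul_inv_add_le_of_add_mul_le (learningRate_pos hd h hG hg T) (by linarith)
  have h4 : realBarrier σ * (learningRate G g ρ T)⁻¹ ≤
      Real.sqrt d * K * Real.sqrt (normSqSum G g ρ T + G ^ 2) := by
    have hs := Real.sqrt_pos.2 hd'
    rw [learningRate_eq' hd h hg, inv_div, ← mul_div_assoc, div_le_iff₀ hs]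
    calc realBarrier σ * Real.sqrt (normSqSum G g ρ T + G ^ 2) ≤
        d * K * Real.sqrt (normSqSum G g ρ T + G ^ 2) := by gcongr
      _ = (Real.sqrt d * Real.sqrt d) * K * Real.sqrt (normSqSum G g ρ T + G ^ 2) := by
        rw [Real.mul_self_sqrt hd'.le]
      _ = _ := by ring
  have h5 : Real.sqrt (normSqSum G g ρ T) ≤ Real.sqrt (normSqSum G g ρ T + G ^ 2) :=
    Real.sqrt_le_sqrt (by linarith [sq_nonneg G])
  have h6 : ∑ τ ∈ Finset.Icc 1 T, (g τ * (ρ τ - σ)).trace.re =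
      ∑ τ ∈ Finset.Icc 1 T, (g τ * ρ τ).trace.re -
        ((∑ τ ∈ Finset.Icc 1 T, g τ) * σ).trace.re := by
    simp only [mul_sub, Matrix.trace_sub, Complex.sub_re, Finset.sum_sub_distrib, Finset.sum_mul,
      Matrix.trace_sum, Complex.re_sum]
  rw [h6]
  have h7 := mul_le_mul_of_nonneg_left h5 (Real.sqrt_nonneg (d : ℝ))
  linarith

end Regret

/-! ### Compactness of the set of density matrices. -/

section Compactness

variable {d : ℕ} {A ρ : Matrix (Fin d) (Fin d) ℂ}

lemma trace_mul_re_le (hA : A.PosSemidef) (hρ : ρ ∈ densityMatrices d) :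
    (A * ρ).trace.re ≤ A.trace.re := by
  have h := abs_trace_mul_re_le Matrix.PosDef.one hρ.1.1 hA
  have h2 : dualForm (1 : Matrix (Fin d) (Fin d) ℂ)⁻¹ ρ ≤ 1 := by
    rw [dualForm, inv_one, mul_one, mul_one]
    simpa [hρ.2] using trace_mul_self_re_le_sq hρ.1
  have h3 : 0 ≤ A.trace.re := (Complex.le_def.mp hA.trace_nonneg).1
  rw [mul_one] at h
  have h4 : Real.sqrt (dualForm (1 : Matrix (Fin d) (Fin d) ℂ)⁻¹ ρ) ≤ 1 := Real.sqrt_le_one.2 h2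
  nlinarith [le_abs_self (A * ρ).trace.re]

lemma isClosed_posSemidef : IsClosed {M : Matrix (Fin d) (Fin d) ℂ | M.PosSemidef} := by
  simp only [Matrix.posSemidef_iff_dotProduct_mulVec, Matrix.IsHermitian, Set.ofPred_and,
    Set.ofPred_forall]
  refine (isClosed_eq (by fun_prop) continuous_id).inter (isClosed_iInter fun x => ?_)
  exact isClosed_le continuous_const
    (Continuous.dotProduct continuous_const
      (Continuous.matrix_mulVec continuous_id continuous_const))

lemma isCompact_densityMatrices : IsCompact (densityMatrices d) := by
  have h1 : IsCompact (Set.univ.pi fun _ : Fin d => Set.univ.pi fun _ : Fin d =>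
      Metric.closedBall (0 : ℂ) 1) :=
    isCompact_univ_pi fun _ => isCompact_univ_pi fun _ => isCompact_closedBall (0 : ℂ) 1
  refine IsCompact.of_isClosed_subset (X := Fin d → Fin d → ℂ) h1 ?_ fun M hM i _ j _ => ?_
  · exact isClosed_posSemidef.inter
      (isClosed_eq (Continuous.matrix_trace continuous_id) continuous_const)
  · rw [mem_closedBall_zero_iff]
    exact (norm_entry_le_trace hM.1 i j).trans_eq (trace_re_eq_one hM)

end Compactness

/-! ### Extended-real expectations. -/

section Expectation

variable {Ω : Type*} [MeasurableSpace Ω] {μ : Measure Ω}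

lemma expectation_eq_coe {X : Ω → EReal} {Y : Ω → ℝ} (hY : Integrable Y μ)
    (hXY : ∀ᵐ ω ∂μ, X ω = (Y ω : EReal)) : expectation μ X = ((∫ ω, Y ω ∂μ : ℝ) : EReal) := by
  rw [← toReal_expectation_coe hY hXY, EReal.coe_toReal]
  all_goals
    have h1 : ∫⁻ ω, (X ω).toENNReal ∂μ ≠ ⊤ := by
      rw [lintegral_congr_ae (hXY.mono fun ω h => by
        simp only [h]; rw [EReal.toENNReal_of_ne_top (EReal.coe_ne_top _), EReal.toReal_coe])]
      exact hY.lintegral_lt_top.ne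
    have h2 : ∫⁻ ω, (-X ω).toENNReal ∂μ ≠ ⊤ := by
      rw [lintegral_congr_ae (hXY.mono fun ω h => by
        simp only [h]
        rw [← EReal.coe_neg, EReal.toENNReal_of_ne_top (EReal.coe_ne_top _), EReal.toReal_coe])]
      exact hY.neg.lintegral_lt_top.ne
    rw [expectation]
    lift ∫⁻ ω, (X ω).toENNReal ∂μ to NNReal using h1 with a
    lift ∫⁻ ω, (-X ω).toENNReal ∂μ to NNReal using h2 with b
    rw [show ((a : ℝ≥0∞) : EReal) - ((b : ℝ≥0∞) : EReal) = ((a - b : ℝ) : EReal) from rfl]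
  · exact EReal.coe_ne_top _
  · exact EReal.coe_ne_bot _

/-- Only an integrable majorant is required, not measurability of `X`. This permits its use for the
loss of a random iterate. -/
lemma expectation_le_coe {X : Ω → EReal} {Y : Ω → ℝ} (hY : Integrable Y μ) (hX : ∀ᵐ ω ∂μ, 0 ≤ X ω)
    (hXY : ∀ᵐ ω ∂μ, X ω ≤ (Y ω : EReal)) : expectation μ X ≤ ((∫ ω, Y ω ∂μ : ℝ) : EReal) := by
  have hY0 : 0 ≤ᵐ[μ] Y := by
    filter_upwards [hX, hXY] with ω h1 h2
    exact_mod_cast h1.trans h2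
  have h2 : ∫⁻ ω, (-X ω).toENNReal ∂μ = 0 := by
    rw [lintegral_congr_ae (g := fun _ => 0), lintegral_zero]
    filter_upwards [hX] with ω h
    exact EReal.toENNReal_of_nonpos (by simpa using h)
  have h1 : ∫⁻ ω, (X ω).toENNReal ∂μ ≤ ENNReal.ofReal (∫ ω, Y ω ∂μ) := by
    rw [ofReal_integral_eq_lintegral_ofReal hY hY0]
    refine lintegral_mono_ae (hXY.mono fun ω h => ?_)
    refine (EReal.toENNReal_le_toENNReal h).trans_eq ?_
    rw [EReal.toENNReal_of_ne_top (EReal.coe_ne_top _), EReal.toReal_coe]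
  rw [expectation, h2]
  simp only [EReal.coe_ennreal_zero, sub_zero]
  refine (EReal.coe_ennreal_le_coe_ennreal_iff.2 h1).trans_eq ?_
  rw [EReal.coe_ennreal_ofReal, max_eq_left (integral_nonneg_of_ae hY0)]

end Expectation

/-- The standing assumptions on the random positive semidefinite matrix defining the loss. -/
structure IsLossData {Ξ : Type*} [MeasurableSpace Ξ] (P : Measure Ξ) {d : ℕ}
    (A : Ξ → Matrix (Fin d) (Fin d) ℂ) : Prop where
  measurable : ∀ i j, Measurable fun ξ => A ξ i j
  posSemidef : ∀ᵐ ξ ∂P, (A ξ).PosSemidef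
  ne_zero : ∀ᵐ ξ ∂P, A ξ ≠ 0
  integrable_log : Integrable (fun ξ => Real.log (A ξ).trace.re) P

/-- The expected logarithmic loss at `ρ` is finite. -/
structure HasFiniteLoss {Ξ : Type*} [MeasurableSpace Ξ] (P : Measure Ξ) {d : ℕ}
    (A : Ξ → Matrix (Fin d) (Fin d) ℂ) (ρ : Matrix (Fin d) (Fin d) ℂ) : Prop where
  pos : ∀ᵐ ξ ∂P, 0 < (A ξ * ρ).trace.re
  integrable : Integrable (fun ξ => Real.log (A ξ * ρ).trace.re) P

/-- The expected logarithmic loss as a real number. -/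
noncomputable def realLoss {Ξ : Type*} [MeasurableSpace Ξ] (P : Measure Ξ) {d : ℕ}
    (A : Ξ → Matrix (Fin d) (Fin d) ℂ) (ρ : Matrix (Fin d) (Fin d) ℂ) : ℝ :=
  ∫ ξ, -Real.log (A ξ * ρ).trace.re ∂P

/-! ### Finiteness of the expected loss and existence of a minimizer. -/

section Loss

variable {Ξ : Type*} [MeasurableSpace Ξ] {P : Measure Ξ} {d : ℕ}
  {A : Ξ → Matrix (Fin d) (Fin d) ℂ} {ρ σ X : Matrix (Fin d) (Fin d) ℂ}

lemma HasFiniteLoss.expLogLoss_eq (h : HasFiniteLoss P A ρ) :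
    expLogLoss P A ρ = (realLoss P A ρ : EReal) := by
  refine expectation_eq_coe h.integrable.neg ?_
  filter_upwards [h.pos] with ξ hξ
  rw [ENNReal.log_ofReal_of_pos hξ]
  rfl

lemma IsLossData.measurable_trace (hA : IsLossData P A) (ρ : Matrix (Fin d) (Fin d) ℂ) :
    Measurable fun ξ => (A ξ * ρ).trace.re := by
  simp only [Matrix.trace, Matrix.diag, Matrix.mul_apply]
  exact Complex.measurable_re.comp (Finset.measurable_sum _ fun i _ =>
    Finset.measurable_sum _ fun j _ => (hA.measurable i j).mul_const _)

lemma IsLossData.trace_pos (hA : IsLossData P A) : ∀ᵐ ξ ∂P, 0 < (A ξ).trace.re := by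
  filter_upwards [hA.posSemidef, hA.ne_zero] with ξ h1 h2
  have h3 := Complex.le_def.mp h1.trace_nonneg
  refine lt_of_le_of_ne h3.1 fun h4 => h2 (h1.trace_eq_zero_iff.mp ?_)
  exact Complex.ext h4.symm h3.2.symm

lemma IsLossData.trace_mul_pos (hA : IsLossData P A) (hρ : ρ.PosDef) :
    ∀ᵐ ξ ∂P, 0 < (A ξ * ρ).trace.re := by
  obtain ⟨c, hc, hlow⟩ := exists_trace_lower hρ
  filter_upwards [hA.posSemidef, hA.trace_pos] with ξ h1 h2
  exact lt_of_lt_of_le (by positivity) (hlow _ h1)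

/-- Here `c tr A ≤ tr(Aρ) ≤ tr A` with `c > 0`, so `log tr(Aρ)` differs from the integrable `log tr
A` by a bounded amount. -/
lemma IsLossData.hasFiniteLoss [IsProbabilityMeasure P] (hA : IsLossData P A) (hρ : ρ.PosDef)
    (hρ' : ρ ∈ densityMatrices d) : HasFiniteLoss P A ρ := by
  obtain ⟨c, hc, hlow⟩ := exists_trace_lower hρ
  refine ⟨hA.trace_mul_pos hρ, ?_⟩
  refine (hA.integrable_log.abs.add (integrable_const |Real.log c|)).mono'
    (Real.measurable_log.comp (hA.measurable_trace ρ)).aestronglyMeasurable ?_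
  filter_upwards [hA.posSemidef, hA.trace_pos, hA.trace_mul_pos hρ] with ξ h1 h2 h3
  have h4 := Real.log_le_log (by positivity) (hlow _ h1)
  have h5 := Real.log_le_log h3 (trace_mul_re_le h1 hρ')
  rw [Real.log_mul hc.ne' h2.ne'] at h4
  rw [Real.norm_eq_abs, abs_le, Pi.add_apply]
  constructor <;> linarith [neg_abs_le (Real.log c), abs_nonneg (Real.log c),
    neg_abs_le (Real.log (A ξ).trace.re), le_abs_self (Real.log (A ξ).trace.re)]

/-- The nonnegative normalized loss `-log (tr(Aρ) / tr A)`. -/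
noncomputable def normalizedLoss (A ρ : Matrix (Fin d) (Fin d) ℂ) : ℝ≥0∞ :=
  (-ENNReal.log (ENNReal.ofReal ((A * ρ).trace.re / A.trace.re))).toENNReal

lemma continuous_normalizedLoss (A : Matrix (Fin d) (Fin d) ℂ) :
    Continuous (normalizedLoss A) := by
  refine EReal.continuous_toENNReal.comp (continuous_neg.comp (ENNReal.continuous_log.comp
    (ENNReal.continuous_ofReal.comp (Continuous.div_const (Complex.continuous_re.comp
      (Continuous.matrix_trace (continuous_const.mul continuous_id))) _))))

lemma IsLossData.measurable_normalizedLoss (hA : IsLossData P A)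
    (ρ : Matrix (Fin d) (Fin d) ℂ) : Measurable fun ξ => normalizedLoss (A ξ) ρ := by
  have h1 := hA.measurable_trace 1
  simp only [mul_one] at h1
  exact EReal.continuous_toENNReal.measurable.comp ((continuous_neg (G := EReal)).measurable.comp
    (ENNReal.measurable_log.comp ((hA.measurable_trace ρ).div h1).ennreal_ofReal))

lemma normalizedLoss_of_pos {A : Matrix (Fin d) (Fin d) ℂ} (h1 : 0 < A.trace.re)
    (h2 : 0 < (A * ρ).trace.re) : normalizedLoss A ρ =
      ENNReal.ofReal (Real.log A.trace.re - Real.log (A * ρ).trace.re) := by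
  rw [normalizedLoss, ENNReal.log_ofReal_of_pos (div_pos h2 h1), Real.log_div h2.ne' h1.ne',
    ← EReal.coe_neg, EReal.toENNReal_of_ne_top (EReal.coe_ne_top _), EReal.toReal_coe, neg_sub]

/-- Fatou's lemma. Normalizing by `tr A` makes the loss nonnegative on density matrices and changes
its expectation only by the constant `𝔼 log tr A`. -/
lemma IsLossData.lowerSemicontinuous (hA : IsLossData P A) :
    LowerSemicontinuous fun ρ => ∫⁻ ξ, normalizedLoss (A ξ) ρ ∂P := by
  have : FirstCountableTopology (Matrix (Fin d) (Fin d) ℂ) :=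
    inferInstanceAs (FirstCountableTopology (Fin d → Fin d → ℂ))
  rw [lowerSemicontinuous_iff_le_liminf]
  intro ρ
  refine le_trans (lintegral_mono fun ξ => ?_) (lintegral_liminf_le hA.measurable_normalizedLoss)
  exact ((continuous_normalizedLoss (A ξ)).tendsto ρ).liminf_eq.ge

lemma IsLossData.hasFiniteLoss_of_ne_top (hA : IsLossData P A) (hρ : ρ ∈ densityMatrices d)
    (h : ∫⁻ ξ, normalizedLoss (A ξ) ρ ∂P ≠ ⊤) : HasFiniteLoss P A ρ := by
  have hpos : ∀ᵐ ξ ∂P, 0 < (A ξ * ρ).trace.re := by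
    filter_upwards [ae_lt_top (hA.measurable_normalizedLoss ρ) h, hA.trace_pos] with ξ h1 h2
    by_contra! h3
    rw [normalizedLoss, ENNReal.ofReal_of_nonpos (div_nonpos_of_nonpos_of_nonneg h3 h2.le)] at h1
    simp at h1
  refine ⟨hpos, ?_⟩
  have h1 : Integrable (fun ξ => Real.log (A ξ).trace.re - Real.log (A ξ * ρ).trace.re) P := by
    have hm := hA.measurable_trace 1
    simp only [mul_one] at hm
    refine ⟨((Real.measurable_log.comp hm).sub
      (Real.measurable_log.comp (hA.measurable_trace ρ))).aestronglyMeasurable, ?_⟩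
    rw [hasFiniteIntegral_iff_ofReal, lt_top_iff_ne_top]
    · convert h using 1
      refine lintegral_congr_ae ?_
      filter_upwards [hpos, hA.trace_pos] with ξ h2 h3
      rw [normalizedLoss_of_pos h3 h2]
    · filter_upwards [hpos, hA.posSemidef] with ξ h2 h3
      exact sub_nonneg.2 (Real.log_le_log h2 (trace_mul_re_le h3 hρ))
  refine (hA.integrable_log.sub h1).congr (Filter.Eventually.of_forall fun ξ => ?_)
  simp

lemma HasFiniteLoss.lintegral_normalizedLoss (hA : IsLossData P A) (hρ : ρ ∈ densityMatrices d)
    (h : HasFiniteLoss P A ρ) : ∫⁻ ξ, normalizedLoss (A ξ) ρ ∂P =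
      ENNReal.ofReal (realLoss P A ρ + ∫ ξ, Real.log (A ξ).trace.re ∂P) := by
  have e : realLoss P A ρ + ∫ ξ, Real.log (A ξ).trace.re ∂P =
      ∫ ξ, (Real.log (A ξ).trace.re - Real.log (A ξ * ρ).trace.re) ∂P := by
    rw [realLoss, integral_neg, integral_sub hA.integrable_log h.integrable]
    ring
  have hi : Integrable (fun ξ => Real.log (A ξ).trace.re - Real.log (A ξ * ρ).trace.re) P :=
    hA.integrable_log.sub h.integrable
  rw [e, ofReal_integral_eq_lintegral_ofReal hi]
  · refine lintegral_congr_ae ?_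
    filter_upwards [h.pos, hA.trace_pos] with ξ h2 h3
    exact normalizedLoss_of_pos h3 h2
  · filter_upwards [h.pos, hA.posSemidef] with ξ h2 h3
    exact sub_nonneg.2 (Real.log_le_log h2 (trace_mul_re_le h3 hρ))

lemma HasFiniteLoss.neg_integral_le (hA : IsLossData P A) (hρ : ρ ∈ densityMatrices d)
    (h : HasFiniteLoss P A ρ) : 0 ≤ realLoss P A ρ + ∫ ξ, Real.log (A ξ).trace.re ∂P := by
  rw [realLoss, integral_neg, neg_add_eq_sub, ← integral_sub hA.integrable_log h.integrable]
  refine integral_nonneg_of_ae ?_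
  filter_upwards [h.pos, hA.posSemidef] with ξ h2 h3
  exact sub_nonneg.2 (Real.log_le_log h2 (trace_mul_re_le h3 hρ))

/-- The negative part of the loss is at most `|log tr A|`, hence integrable. A value other than `+∞`
therefore forces the positive part to be integrable too, and the convention `-log 0 = +∞` excludes a
vanishing trace. -/
lemma IsLossData.hasFiniteLoss_of_expLogLoss_ne_top (hA : IsLossData P A)
    (hρ : ρ ∈ densityMatrices d) (h : expLogLoss P A ρ ≠ ⊤) : HasFiniteLoss P A ρ := by
  refine hA.hasFiniteLoss_of_ne_top hρ ?_
  rw [expLogLoss, expectation] at h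
  set f : Ξ → EReal := fun ξ => -ENNReal.log (ENNReal.ofReal (A ξ * ρ).trace.re)
  have hneg : ∫⁻ ξ, (-f ξ).toENNReal ∂P ≠ ⊤ := by
    refine ne_top_of_le_ne_top hA.integrable_log.abs.lintegral_lt_top.ne (lintegral_mono_ae ?_)
    filter_upwards [hA.posSemidef, hA.trace_pos] with ξ h1 h2
    have h3 : -f ξ ≤ ((|Real.log (A ξ).trace.re| : ℝ) : EReal) := by
      rw [neg_neg]
      refine (ENNReal.log_monotone (ENNReal.ofReal_le_ofReal (trace_mul_re_le h1 hρ))).trans ?_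
      rw [ENNReal.log_ofReal_of_pos h2, EReal.coe_le_coe_iff]
      exact le_abs_self _
    refine (EReal.toENNReal_le_toENNReal h3).trans_eq ?_
    rw [EReal.toENNReal_of_ne_top (EReal.coe_ne_top _), EReal.toReal_coe]
  have hpos : ∫⁻ ξ, (f ξ).toENNReal ∂P ≠ ⊤ := by
    intro h0
    apply h
    obtain ⟨b, hb⟩ := WithTop.ne_top_iff_exists.1 hneg
    rw [h0, ← hb]
    exact EReal.top_sub_coe _
  refine ne_top_of_le_ne_top (ENNReal.add_ne_top.2
    ⟨hpos, hA.integrable_log.abs.lintegral_lt_top.ne⟩) ?_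
  rw [← lintegral_add_right' _ hA.integrable_log.abs.aemeasurable.ennreal_ofReal]
  refine lintegral_mono_ae ?_
  filter_upwards [hA.trace_pos] with ξ h2
  rcases le_or_gt (A ξ * ρ).trace.re 0 with h3 | h3
  · have : (f ξ).toENNReal = ⊤ := by
      simp only [f]
      rw [ENNReal.ofReal_of_nonpos h3]
      simp
    rw [this]
    simp
  · have : f ξ = ((-Real.log (A ξ * ρ).trace.re : ℝ) : EReal) := by
      simp only [f]
      rw [ENNReal.log_ofReal_of_pos h3, EReal.coe_neg]
    rw [this, normalizedLoss_of_pos h2 h3, EReal.toENNReal_of_ne_top (EReal.coe_ne_top _),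
      EReal.toReal_coe]
    refine le_trans (ENNReal.ofReal_le_ofReal ?_) ENNReal.ofReal_add_le
    linarith [le_abs_self (Real.log (A ξ).trace.re)]

/-- The expected logarithmic loss attains a finite minimum. -/
theorem IsLossData.exists_min [IsProbabilityMeasure P] (hA : IsLossData P A) (hd : 0 < d) :
    ∃ ρ ∈ densityMatrices d, HasFiniteLoss P A ρ ∧
      (∀ σ ∈ densityMatrices d, HasFiniteLoss P A σ → realLoss P A ρ ≤ realLoss P A σ) ∧
      IsLeast (expLogLoss P A '' densityMatrices d) (realLoss P A ρ : EReal) := by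
  have hd' : (0 : ℝ) < d := Nat.cast_pos.2 hd
  have hI := smul_one_mem_densityMatrices hd
  obtain ⟨ρ, hρ, hmin⟩ := (hA.lowerSemicontinuous.lowerSemicontinuousOn
    (densityMatrices d)).exists_isMinOn ⟨_, hI⟩ isCompact_densityMatrices
  rw [isMinOn_iff] at hmin
  have hfin : HasFiniteLoss P A ρ := by
    refine hA.hasFiniteLoss_of_ne_top hρ (ne_top_of_le_ne_top ?_ (hmin _ hI))
    rw [(hA.hasFiniteLoss (posDef_smul_one (by positivity)) hI).lintegral_normalizedLoss hA hI]
    exact ENNReal.ofReal_ne_top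
  have hle : ∀ σ ∈ densityMatrices d, HasFiniteLoss P A σ →
      realLoss P A ρ ≤ realLoss P A σ := fun σ hσ h => by
    have h1 := hmin σ hσ
    rw [hfin.lintegral_normalizedLoss hA hρ, h.lintegral_normalizedLoss hA hσ,
      ENNReal.ofReal_le_ofReal_iff (h.neg_integral_le hA hσ)] at h1
    linarith
  refine ⟨ρ, hρ, hfin, hle, ⟨ρ, hρ, hfin.expLogLoss_eq⟩, ?_⟩
  rintro _ ⟨σ, hσ, rfl⟩
  by_cases htop : expLogLoss P A σ = ⊤
  · rw [htop]; exact le_top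
  · have h := hA.hasFiniteLoss_of_expLogLoss_ne_top hσ htop
    rw [h.expLogLoss_eq, EReal.coe_le_coe_iff]
    exact hle σ hσ h

end Loss

/-! ### The gradient: dual norm bound, convexity and self-bounding. -/

section Gradient

variable {Ξ : Type*} [MeasurableSpace Ξ] {P : Measure Ξ} {d : ℕ}
  {A : Ξ → Matrix (Fin d) (Fin d) ℂ} {ρ σ X : Matrix (Fin d) (Fin d) ℂ}

lemma IsLossData.integrable_entry_div [IsProbabilityMeasure P] (hA : IsLossData P A)
    (hρ : ρ.PosDef) (i j : Fin d) :
    Integrable (fun ξ => A ξ i j / (((A ξ * ρ).trace.re : ℝ) : ℂ)) P := by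
  obtain ⟨c, hc, hlow⟩ := exists_trace_lower hρ
  refine Integrable.of_bound ((hA.measurable i j).div
    (Complex.measurable_ofReal.comp (hA.measurable_trace ρ))).aestronglyMeasurable (1 / c) ?_
  filter_upwards [hA.posSemidef, hA.trace_mul_pos hρ] with ξ h1 hpos
  have h3 := hlow _ h1
  rw [norm_div, Complex.norm_real, Real.norm_eq_abs, abs_of_pos hpos, div_le_div_iff₀ hpos hc]
  have := norm_entry_le_trace h1 i j
  nlinarith

lemma trace_mul_re_eq_sum (M X : Matrix (Fin d) (Fin d) ℂ) :
    (M * X).trace.re = ∑ i, ∑ j, (M i j * X j i).re := by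
  simp only [Matrix.trace, Matrix.diag, Matrix.mul_apply, Complex.re_sum]

lemma trace_ratio_eq_sum (M ρ X : Matrix (Fin d) (Fin d) ℂ) :
    (M * X).trace.re / (M * ρ).trace.re =
      ∑ i, ∑ j, (M i j / (((M * ρ).trace.re : ℝ) : ℂ) * X j i).re := by
  rw [← Complex.div_ofReal_re]
  generalize (((M * ρ).trace.re : ℝ) : ℂ) = z
  simp only [Matrix.trace, Matrix.diag, Matrix.mul_apply, ← Complex.re_sum,
    Finset.sum_div, div_mul_eq_mul_div]

lemma IsLossData.integrable_ratio [IsProbabilityMeasure P] (hA : IsLossData P A) (hρ : ρ.PosDef)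
    (X : Matrix (Fin d) (Fin d) ℂ) :
    Integrable (fun ξ => (A ξ * X).trace.re / (A ξ * ρ).trace.re) P := by
  simp only [trace_ratio_eq_sum]
  exact integrable_finsetSum _ fun i _ => integrable_finsetSum _ fun j _ =>
    ((hA.integrable_entry_div hρ i j).mul_const (X j i)).re

lemma IsLossData.integrable_neg_ratio [IsProbabilityMeasure P] (hA : IsLossData P A)
    (hρ : ρ.PosDef) (X : Matrix (Fin d) (Fin d) ℂ) :
    Integrable (fun ξ => -((A ξ * X).trace.re / (A ξ * ρ).trace.re)) P :=
  (hA.integrable_ratio hρ X).neg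

lemma HasFiniteLoss.integrable_neg (h : HasFiniteLoss P A ρ) :
    Integrable (fun ξ => -Real.log (A ξ * ρ).trace.re) P :=
  h.integrable.neg

lemma IsLossData.trace_lossGradient_mul [IsProbabilityMeasure P] (hA : IsLossData P A)
    (hρ : ρ.PosDef) (X : Matrix (Fin d) (Fin d) ℂ) :
    (lossGradient P A ρ * X).trace.re =
      -∫ ξ, (A ξ * X).trace.re / (A ξ * ρ).trace.re ∂P := by
  have hq : ∀ i j, Integrable
      (fun ξ => A ξ i j / (((A ξ * ρ).trace.re : ℝ) : ℂ) * X j i) P :=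
    fun i j => (hA.integrable_entry_div hρ i j).mul_const (X j i)
  have hr : ∀ i j, Integrable
      (fun ξ => (A ξ i j / (((A ξ * ρ).trace.re : ℝ) : ℂ) * X j i).re) P :=
    fun i j => (hq i j).re
  have e3 : ∀ i j, (∫ ξ, A ξ i j / (((A ξ * ρ).trace.re : ℝ) : ℂ) * X j i ∂P).re =
      ∫ ξ, (A ξ i j / (((A ξ * ρ).trace.re : ℝ) : ℂ) * X j i).re ∂P :=
    fun i j => (integral_re (hq i j)).symm
  simp only [trace_ratio_eq_sum]
  rw [trace_mul_re_eq_sum, integral_finsetSum _ fun i _ => integrable_finsetSum _ fun j _ =>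
    hr i j, ← Finset.sum_neg_distrib]
  refine Finset.sum_congr rfl fun i _ => ?_
  rw [integral_finsetSum _ fun j _ => hr i j, ← Finset.sum_neg_distrib]
  refine Finset.sum_congr rfl fun j _ => ?_
  rw [lossGradient, Matrix.of_apply, neg_mul, ← integral_mul_const, Complex.neg_re]
  exact congrArg Neg.neg (e3 i j)

lemma IsLossData.isHermitian_lossGradient (hA : IsLossData P A)
    (ρ : Matrix (Fin d) (Fin d) ℂ) : (lossGradient P A ρ).IsHermitian := by
  ext i j
  simp only [lossGradient, Matrix.conjTranspose_apply, Matrix.of_apply, star_neg]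
  congr 1
  rw [← starRingEnd_apply, ← integral_conj]
  refine integral_congr_ae ?_
  filter_upwards [hA.posSemidef] with ξ h
  rw [map_div₀, Complex.conj_ofReal, starRingEnd_apply, h.1.apply]

/-- Testing the gradient `U` against `ρUρ`, of squared local norm `N = dualForm ρ U`, and bounding
each ratio in the expectation by that norm gives `N ≤ √N`. -/
lemma IsLossData.dualForm_lossGradient_le [IsProbabilityMeasure P] (hA : IsLossData P A)
    (hρ : ρ.PosDef) : dualForm ρ (lossGradient P A ρ) ≤ 1 := by
  have hH := hA.isHermitian_lossGradient ρ
  set U := lossGradient P A ρ with hU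
  have h0 := dualForm_nonneg hρ hH
  have hT : (ρ * U * ρ).IsHermitian := by
    have := Matrix.isHermitian_mul_mul_conjTranspose ρ hH
    rwa [hρ.1.eq] at this
  have h1 : dualForm ρ U ≤ Real.sqrt (dualForm ρ U) := by
    have e1 : dualForm ρ U = (U * (ρ * U * ρ)).trace.re := by simp only [dualForm, mul_assoc]
    calc dualForm ρ U = (U * (ρ * U * ρ)).trace.re := e1
      _ = ∫ ξ, -((A ξ * (ρ * U * ρ)).trace.re / (A ξ * ρ).trace.re) ∂P := by
        rw [hU, hA.trace_lossGradient_mul hρ, integral_neg]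
      _ ≤ ∫ _, Real.sqrt (dualForm ρ U) ∂P := by
        refine integral_mono_ae (hA.integrable_neg_ratio hρ _) (integrable_const _) ?_
        filter_upwards [hA.posSemidef, hA.trace_mul_pos hρ] with ξ h2 h3
        have h4 := abs_trace_mul_re_le hρ hT h2
        rw [dualForm_inv_mul_mul hρ] at h4
        rw [← neg_div, div_le_iff₀ h3]
        exact (neg_le_abs _).trans h4
      _ = _ := by simp
  have h2 := Real.sqrt_nonneg (dualForm ρ U)
  have h3 := Real.sq_sqrt h0
  nlinarith

/-- Convexity of the expected logarithmic loss, as a gradient inequality. -/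
lemma IsLossData.realLoss_sub_le [IsProbabilityMeasure P] (hA : IsLossData P A) (hρ : ρ.PosDef)
    (h : HasFiniteLoss P A ρ) (h' : HasFiniteLoss P A σ) :
    realLoss P A ρ - realLoss P A σ ≤ (lossGradient P A ρ * (ρ - σ)).trace.re := by
  rw [hA.trace_lossGradient_mul hρ, ← integral_neg, realLoss, realLoss,
    ← integral_sub h.integrable_neg h'.integrable_neg]
  refine integral_mono_ae (h.integrable_neg.sub h'.integrable_neg)
    (hA.integrable_neg_ratio hρ _) ?_
  filter_upwards [h.pos, h'.pos] with ξ h1 h2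
  have h3 := Real.log_le_sub_one_of_pos (div_pos h2 h1)
  rw [Real.log_div h2.ne' h1.ne'] at h3
  rw [mul_sub, Matrix.trace_sub, Complex.sub_re, sub_div, div_self h1.ne']
  linarith

/-- The self-bounding property: the squared dual norm of the shifted gradient is controlled by the
suboptimality. -/
lemma IsLossData.dualForm_shifted_lossGradient_le [IsProbabilityMeasure P] (hA : IsLossData P A)
    (hd : 0 < d) (hρ : ρ.PosDef) (hρ' : ρ ∈ densityMatrices d) {m : ℝ}
    (hm : ∀ σ ∈ densityMatrices d, HasFiniteLoss P A σ → m ≤ realLoss P A σ) :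
    dualForm ρ (lossGradient P A ρ + alphaShift ρ (lossGradient P A ρ) •
      (1 : Matrix (Fin d) (Fin d) ℂ)) ≤ 4 * (realLoss P A ρ - m) := by
  have hH := hA.isHermitian_lossGradient ρ
  have h1 := hA.dualForm_lossGradient_le hρ
  have h2 := dualForm_alphaShift_le (U := lossGradient P A ρ) hd hρ 0
  rw [zero_smul, add_zero] at h2
  have h3 := trace_mul_alphaShift (U := lossGradient P A ρ) hd hρ
  set α := alphaShift ρ (lossGradient P A ρ)
  set U := lossGradient P A ρ + α • (1 : Matrix (Fin d) (Fin d) ℂ) with hU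
  have hUH : U.IsHermitian := isHermitian_add_smul_one hH α
  have hT : (ρ * U * ρ).IsHermitian := by
    have := Matrix.isHermitian_mul_mul_conjTranspose ρ hUH
    rwa [hρ.1.eq] at this
  have htr : (ρ * U * ρ).trace.re = 0 := by
    rw [← h3, Matrix.trace_mul_comm, ← mul_assoc, Matrix.trace_mul_comm, mul_assoc]
  -- By the choice of the shift, this direction has zero trace. Its local norm is `√N / 2 ≤ 1/2`
  -- with `N = dualForm ρ U ≤ 1`, so `ρ + X` stays a density matrix. The change in loss is at most
  -- `-N/2 + N/4`, hence the factor `4`.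
  set X := (-(1 / 2) : ℝ) • (ρ * U * ρ) with hX
  have hXH : X.IsHermitian := isHermitian_smul hT _
  have hXn : dualForm ρ⁻¹ X = dualForm ρ U / 4 := by
    rw [hX, dualForm_smul, dualForm_inv_mul_mul hρ]; ring
  have hn0 := dualForm_nonneg hρ hUH
  have hpd := (posDef_add_and_log_det_ge hρ hXH (by rw [hXn]; linarith)).1
  have hmem : ρ + X ∈ densityMatrices d := by
    refine ⟨hpd.posSemidef, Complex.ext ?_ ?_⟩
    · rw [Matrix.trace_add, Complex.add_re, trace_re_eq_one hρ', hX, Matrix.trace_smul,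
        Complex.real_smul, Complex.re_ofReal_mul, htr]
      simp
    · exact (Complex.le_def.mp hpd.posSemidef.trace_nonneg).2.symm
  have hf := hA.hasFiniteLoss hρ hρ'
  have hf' := hA.hasFiniteLoss hpd hmem
  have hgX : (lossGradient P A ρ * X).trace.re = -(1 / 2) * dualForm ρ U := by
    have e1 : dualForm ρ U = (U * (ρ * U * ρ)).trace.re := by simp only [dualForm, mul_assoc]
    have e2 : (U * (ρ * U * ρ)).trace.re = (lossGradient P A ρ * (ρ * U * ρ)).trace.re := by
      conv_lhs => rw [hU]
      rw [add_mul, Matrix.smul_mul, one_mul, Matrix.trace_add, Complex.add_re, Matrix.trace_smul,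
        Complex.real_smul, Complex.re_ofReal_mul, ← hU, htr, mul_zero, add_zero]
    rw [hX, Matrix.mul_smul, Matrix.trace_smul, Complex.real_smul, Complex.re_ofReal_mul, e1, e2]
  have hdesc : realLoss P A (ρ + X) ≤ realLoss P A ρ + (lossGradient P A ρ * X).trace.re +
      dualForm ρ U / 4 := by
    have e : realLoss P A ρ + (lossGradient P A ρ * X).trace.re + dualForm ρ U / 4 =
        ∫ ξ, (-Real.log (A ξ * ρ).trace.re + -((A ξ * X).trace.re / (A ξ * ρ).trace.re) +
          dualForm ρ U / 4) ∂P := by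
      have hi : Integrable (fun ξ => -Real.log (A ξ * ρ).trace.re +
          -((A ξ * X).trace.re / (A ξ * ρ).trace.re)) P :=
        hf.integrable_neg.add (hA.integrable_neg_ratio hρ X)
      rw [integral_add hi (integrable_const _),
        integral_add hf.integrable_neg (hA.integrable_neg_ratio hρ X), realLoss,
        hA.trace_lossGradient_mul hρ, integral_neg, integral_neg]
      simp
    rw [e, realLoss]
    refine integral_mono_ae hf'.integrable_neg
      ((hf.integrable_neg.add (hA.integrable_neg_ratio hρ X)).add (integrable_const _)) ?_
    filter_upwards [hA.posSemidef, hf.pos] with ξ h4 h5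
    have h6 := abs_trace_mul_re_le hρ hXH h4
    rw [hXn] at h6
    have h7 : |(A ξ * X).trace.re / (A ξ * ρ).trace.re| ≤ Real.sqrt (dualForm ρ U / 4) := by
      rwa [abs_div, abs_of_pos h5, div_le_iff₀ h5]
    have h8 : Real.sqrt (dualForm ρ U / 4) ≤ 1 / 2 := by
      rw [Real.sqrt_le_left (by norm_num)]
      linarith
    have h9 := sub_sq_le_log_one_add (h7.trans h8)
    have h10 : ((A ξ * X).trace.re / (A ξ * ρ).trace.re) ^ 2 ≤ dualForm ρ U / 4 := by
      rw [← sq_abs, ← Real.sq_sqrt (show 0 ≤ dualForm ρ U / 4 by positivity)]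
      gcongr
    have h11 : (A ξ * (ρ + X)).trace.re =
        (A ξ * ρ).trace.re * (1 + (A ξ * X).trace.re / (A ξ * ρ).trace.re) := by
      rw [mul_add, Matrix.trace_add, Complex.add_re]
      field_simp
    have h12 : 0 < 1 + (A ξ * X).trace.re / (A ξ * ρ).trace.re := by
      linarith [(abs_le.1 (h7.trans h8)).1]
    rw [h11, Real.log_mul h5.ne' h12.ne']
    linarith
  have := hm _ hmem hf'
  rw [hgX] at hdesc
  linarith

/-- The loss of a mixture with the maximally mixed state. -/
lemma IsLossData.realLoss_mix_le [IsProbabilityMeasure P] (hA : IsLossData P A)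
    (h : HasFiniteLoss P A ρ) {c : ℝ} (hc : 0 < c)
    (h' : HasFiniteLoss P A (c • ρ + ((1 - c) / d) • (1 : Matrix (Fin d) (Fin d) ℂ)))
    (hc1 : c ≤ 1) :
    realLoss P A (c • ρ + ((1 - c) / d) • (1 : Matrix (Fin d) (Fin d) ℂ)) ≤
      realLoss P A ρ - Real.log c := by
  have e : realLoss P A ρ - Real.log c = ∫ ξ, (-Real.log (A ξ * ρ).trace.re - Real.log c) ∂P := by
    rw [integral_sub h.integrable_neg (integrable_const _), realLoss]
    simp
  rw [e, realLoss]
  refine integral_mono_ae h'.integrable_neg (h.integrable_neg.sub (integrable_const _)) ?_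
  filter_upwards [hA.posSemidef, h.pos] with ξ h1 h2
  have h3 : c * (A ξ * ρ).trace.re ≤
      (A ξ * (c • ρ + ((1 - c) / d) • (1 : Matrix (Fin d) (Fin d) ℂ))).trace.re := by
    rw [mul_add, Matrix.mul_smul, Matrix.mul_smul, mul_one, Matrix.trace_add, Matrix.trace_smul,
      Matrix.trace_smul, Complex.add_re, Complex.real_smul, Complex.real_smul,
      Complex.re_ofReal_mul, Complex.re_ofReal_mul]
    have h4 : 0 ≤ (A ξ).trace.re := (Complex.le_def.mp h1.trace_nonneg).1
    have h5 : 0 ≤ (1 - c) / d := div_nonneg (by linarith) (Nat.cast_nonneg d)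
    nlinarith [mul_nonneg h5 h4]
  have h4 := Real.log_le_log (by positivity) h3
  rw [Real.log_mul hc.ne' h2.ne'] at h4
  linarith

lemma averagedIterate_posDef {ρ : ℕ → Matrix (Fin d) (Fin d) ℂ} {t : ℕ} (ht : 1 ≤ t)
    (h : ∀ τ, 1 ≤ τ → (ρ τ).PosDef) : (averagedIterate ρ t).PosDef := by
  have ht' : (0 : ℝ) < t := by exact_mod_cast ht
  refine Matrix.PosDef.smul ?_ (by positivity)
  obtain ⟨k, rfl⟩ := Nat.exists_eq_add_of_le' ht
  rw [Finset.sum_Icc_succ_top (by omega)]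
  exact (h _ (by omega)).posSemidef_add (Matrix.posSemidef_sum _ fun τ hτ =>
    (h _ (Finset.mem_Icc.1 hτ).1).posSemidef)

lemma averagedIterate_mem {ρ : ℕ → Matrix (Fin d) (Fin d) ℂ} {t : ℕ} (ht : 1 ≤ t)
    (h : ∀ τ, 1 ≤ τ → ρ τ ∈ densityMatrices d) : averagedIterate ρ t ∈ densityMatrices d := by
  have ht' : (0 : ℝ) < t := by exact_mod_cast ht
  refine ⟨Matrix.PosSemidef.smul (Matrix.posSemidef_sum _ fun τ hτ =>
    (h _ (Finset.mem_Icc.1 hτ).1).1) (by positivity), ?_⟩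
  rw [averagedIterate, Matrix.trace_smul, Matrix.trace_sum,
    Finset.sum_congr rfl fun τ hτ => (h _ (Finset.mem_Icc.1 hτ).1).2]
  simp [(show (t : ℂ) ≠ 0 by exact_mod_cast ht'.ne')]

/-- Jensen's inequality for the concave logarithm, pointwise in `ξ` and then integrated. -/
lemma realLoss_averagedIterate_le {ρ : ℕ → Matrix (Fin d) (Fin d) ℂ} {t : ℕ} (ht : 1 ≤ t)
    (h : ∀ τ, 1 ≤ τ → HasFiniteLoss P A (ρ τ)) (h' : HasFiniteLoss P A (averagedIterate ρ t)) :
    realLoss P A (averagedIterate ρ t) ≤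
      (t : ℝ)⁻¹ * ∑ τ ∈ Finset.Icc 1 t, realLoss P A (ρ τ) := by
  have ht' : (0 : ℝ) < t := by exact_mod_cast ht
  have hi : ∀ τ ∈ Finset.Icc 1 t, Integrable (fun ξ => -Real.log (A ξ * ρ τ).trace.re) P :=
    fun τ hτ => (h τ (Finset.mem_Icc.1 hτ).1).integrable_neg
  simp only [realLoss]
  rw [← integral_finsetSum _ hi, ← integral_const_mul]
  refine integral_mono_ae h'.integrable_neg ((integrable_finsetSum _ hi).const_mul _) ?_
  have hpos : ∀ᵐ ξ ∂P, ∀ τ : ℕ, 1 ≤ τ → 0 < (A ξ * ρ τ).trace.re := by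
    rw [ae_all_iff]
    intro τ
    by_cases hτ : 1 ≤ τ
    · filter_upwards [(h τ hτ).pos] with ξ hξ _ using hξ
    · exact Filter.Eventually.of_forall fun ξ h => absurd h hτ
  filter_upwards [hpos] with ξ hξ
  have h1 := strictConcaveOn_log_Ioi.concaveOn.le_map_sum (t := Finset.Icc 1 t)
    (w := fun _ => (t : ℝ)⁻¹) (p := fun τ => (A ξ * ρ τ).trace.re)
    (fun _ _ => by positivity) (by simp [ht'.ne']) fun τ hτ => hξ τ (Finset.mem_Icc.1 hτ).1
  have h2 : (A ξ * averagedIterate ρ t).trace.re =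
      ∑ τ ∈ Finset.Icc 1 t, (t : ℝ)⁻¹ • (A ξ * ρ τ).trace.re := by
    rw [averagedIterate, Matrix.mul_smul, Matrix.trace_smul, Complex.real_smul,
      Complex.re_ofReal_mul, Finset.mul_sum, Matrix.trace_sum, Complex.re_sum, Finset.mul_sum]
    simp only [smul_eq_mul]
  rw [h2, Finset.sum_neg_distrib, mul_neg, neg_le_neg_iff, Finset.mul_sum]
  simpa only [smul_eq_mul] using h1

end Gradient

/-! ### Measurability and integration of random matrices. -/

lemma measurable_history {Ω : Type*} {d : ℕ}
    (g ρ : ℕ → Ω → Matrix (Fin d) (Fin d) ℂ) {t : ℕ} (ht : 1 ≤ t)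
    (i j : Fin d) : Measurable[history g ρ t] fun ω => ρ t ω i j := by
  rw [measurable_iff_comap_le]
  refine le_trans ?_ le_sup_right
  refine le_trans ?_ (le_iSup₂ (f := fun τ (_ : τ ∈ Set.Icc 1 t) => sigmaOf (ρ τ)) t ⟨ht, le_rfl⟩)
  exact le_iSup₂ (f := fun i j => MeasurableSpace.comap (fun ω => ρ t ω i j) inferInstance) i j

section RandomMatrix

variable {Ω : Type*} [MeasurableSpace Ω] {μ : Measure Ω} {d : ℕ}

lemma integral_trace_mul_re {M X : Ω → Matrix (Fin d) (Fin d) ℂ}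
    (h : ∀ i j, Integrable (fun ω => X ω j i * M ω i j) μ) :
    Integrable (fun ω => (M ω * X ω).trace.re) μ ∧
      ∫ ω, (M ω * X ω).trace.re ∂μ = ∑ i, ∑ j, (∫ ω, X ω j i * M ω i j ∂μ).re := by
  have hr : ∀ i j, Integrable (fun ω => (X ω j i * M ω i j).re) μ := fun i j => (h i j).re
  have e : (fun ω => (M ω * X ω).trace.re) = fun ω => ∑ i, ∑ j, (X ω j i * M ω i j).re := by
    funext ω
    simp only [trace_mul_re_eq_sum, mul_comm]
  rw [e]
  refine ⟨integrable_finsetSum _ fun i _ => integrable_finsetSum _ fun j _ => hr i j, ?_⟩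
  rw [integral_finsetSum _ fun i _ => integrable_finsetSum _ fun j _ => hr i j]
  refine Finset.sum_congr rfl fun i _ => ?_
  rw [integral_finsetSum _ fun j _ => hr i j]
  exact Finset.sum_congr rfl fun j _ => integral_re (h i j)

lemma aemeasurable_mul_apply {M N : Ω → Matrix (Fin d) (Fin d) ℂ}
    (hM : ∀ i j, AEMeasurable (fun ω => M ω i j) μ)
    (hN : ∀ i j, AEMeasurable (fun ω => N ω i j) μ) (i j : Fin d) :
    AEMeasurable (fun ω => (M ω * N ω) i j) μ := by
  simp only [Matrix.mul_apply]
  exact Finset.aemeasurable_fun_sum _ fun k _ => (hM i k).mul (hN k j)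

lemma aemeasurable_dualForm {M N : Ω → Matrix (Fin d) (Fin d) ℂ}
    (hM : ∀ i j, AEMeasurable (fun ω => M ω i j) μ)
    (hN : ∀ i j, AEMeasurable (fun ω => N ω i j) μ) :
    AEMeasurable (fun ω => dualForm (M ω) (N ω)) μ := by
  have h := aemeasurable_mul_apply (aemeasurable_mul_apply (aemeasurable_mul_apply hN hM) hN) hM
  simp only [dualForm, Matrix.trace, Matrix.diag]
  exact Complex.measurable_re.comp_aemeasurable (Finset.aemeasurable_fun_sum _ fun k _ => h k k)

lemma sigmaOf_le {X : Ω → Matrix (Fin d) (Fin d) ℂ} (hX : ∀ i j, Measurable fun ω => X ω i j) :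
    sigmaOf X ≤ ‹MeasurableSpace Ω› :=
  iSup₂_le fun i j => (hX i j).comap_le

lemma history_le {g ρ : ℕ → Ω → Matrix (Fin d) (Fin d) ℂ}
    (hg : ∀ t, 1 ≤ t → ∀ i j, Measurable fun ω => g t ω i j)
    (hρ : ∀ t, 1 ≤ t → ∀ i j, Measurable fun ω => ρ t ω i j) (t : ℕ) :
    history g ρ t ≤ ‹MeasurableSpace Ω› :=
  sup_le (iSup₂_le fun τ hτ => sigmaOf_le (hg τ hτ.1))
    (iSup₂_le fun τ hτ => sigmaOf_le (hρ τ hτ.1))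

end RandomMatrix

/-! ### Consequences of the oracle assumptions. -/

section Oracle

variable {Ω : Type*} [MeasurableSpace Ω] {μ : Measure Ω}
  {Ξ : Type*} [MeasurableSpace Ξ] {P : Measure Ξ} {d : ℕ}
  {A : Ξ → Matrix (Fin d) (Fin d) ℂ} {G σ : ℝ} {g ρ : ℕ → Ω → Matrix (Fin d) (Fin d) ℂ}

lemma IsStochasticOracle.integrable_lossGradient (hg : IsStochasticOracle μ P A G σ g ρ)
    {t : ℕ} (ht : 1 ≤ t) (i j : Fin d) :
    Integrable (fun ω => lossGradient P A (ρ t ω) i j) μ :=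
  integrable_condExp.congr (hg.unbiased t ht i j)

variable [IsProbabilityMeasure μ]

/-- The expectation of a linear functional of the gradient estimate that is determined by the
history. -/
lemma IsStochasticOracle.integral_trace_mul (hg : IsStochasticOracle μ P A G σ g ρ)
    (hρ : ∀ t, 1 ≤ t → ∀ i j, Measurable fun ω => ρ t ω i j) {t : ℕ} (ht : 1 ≤ t)
    {X : Ω → Matrix (Fin d) (Fin d) ℂ} {C : ℝ}
    (hX : ∀ i j, Measurable[history g ρ t] fun ω => X ω i j) (hC : ∀ i j ω, ‖X ω i j‖ ≤ C) :
    Integrable (fun ω => (g t ω * X ω).trace.re) μ ∧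
    Integrable (fun ω => (lossGradient P A (ρ t ω) * X ω).trace.re) μ ∧
    ∫ ω, (g t ω * X ω).trace.re ∂μ = ∫ ω, (lossGradient P A (ρ t ω) * X ω).trace.re ∂μ := by
  have hle := history_le hg.measurable hρ t
  have h1 : ∀ i j, Integrable (fun ω => X ω j i * g t ω i j) μ := fun i j =>
    (hg.integrable t ht i j).bdd_mul ((hX j i).mono hle le_rfl).aestronglyMeasurable
      (Filter.Eventually.of_forall (hC j i))
  have h2 : ∀ i j, Integrable (fun ω => X ω j i * lossGradient P A (ρ t ω) i j) μ := fun i j =>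
    (hg.integrable_lossGradient ht i j).bdd_mul ((hX j i).mono hle le_rfl).aestronglyMeasurable
      (Filter.Eventually.of_forall (hC j i))
  obtain ⟨i1, e1⟩ := integral_trace_mul_re h1
  obtain ⟨i2, e2⟩ := integral_trace_mul_re (M := fun ω => lossGradient P A (ρ t ω)) h2
  refine ⟨i1, i2, ?_⟩
  rw [e1, e2]
  refine Finset.sum_congr rfl fun i _ => Finset.sum_congr rfl fun j _ => ?_
  congr 1
  rw [← integral_condExp hle]
  refine integral_congr_ae ?_
  -- The history-measurable factor is pulled out of the conditional expectation, and unbiasedness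
  -- identifies what is left.
  have h3 := condExp_bilin_of_stronglyMeasurable_left (m := history g ρ t)
    (ContinuousLinearMap.mul ℝ ℂ) (hX j i).stronglyMeasurable (h1 i j) (hg.integrable t ht i j)
  filter_upwards [h3, hg.unbiased t ht i j] with ω h4 h5
  rw [← h5]
  exact h4

lemma norm_entry_le_one {ρ : Matrix (Fin d) (Fin d) ℂ} (h : ρ ∈ densityMatrices d) (i j : Fin d) :
    ‖ρ i j‖ ≤ 1 :=
  (norm_entry_le_trace h.1 i j).trans_eq (trace_re_eq_one h)

variable [IsProbabilityMeasure P]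

/-- Always `tr(∇f(ρ) ρ) = -1`, so by unbiasedness `𝔼 tr(g₁ρ₁) = -1`. With `G ≤ 0` the dual norm of
`g₁`, and hence this trace, would vanish almost surely. Positivity of `G` keeps the learning rates
nonzero. -/
lemma IsStochasticOracle.bound_pos (hg : IsStochasticOracle μ P A G σ g ρ) (hA : IsLossData P A)
    (hρm : ∀ t, 1 ≤ t → ∀ i j, Measurable fun ω => ρ t ω i j)
    (hρ : ∀ ω, ρ 1 ω ∈ densityMatrices d ∧ (ρ 1 ω).PosDef) : 0 < G := by
  obtain ⟨-, -, h⟩ := hg.integral_trace_mul hρm le_rfl (X := ρ 1) (C := 1)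
    (measurable_history g ρ le_rfl) (fun i j ω => norm_entry_le_one (hρ ω).1 i j)
  have h1 : ∀ ω, (lossGradient P A (ρ 1 ω) * ρ 1 ω).trace.re = -1 := fun ω => by
    rw [hA.trace_lossGradient_mul (hρ ω).2, integral_congr_ae (g := fun _ => (1 : ℝ))]
    · simp
    · filter_upwards [hA.trace_mul_pos (hρ ω).2] with ξ hξ
      exact div_self hξ.ne'
  simp only [h1] at h
  by_contra! hG
  have h2 : ∫ ω, (g 1 ω * ρ 1 ω).trace.re ∂μ = 0 := by
    refine integral_eq_zero_of_ae ?_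
    filter_upwards [hg.norm_le 1 le_rfl] with ω hω
    have h3 := trace_mul_re_sq_le_dualForm (hρ ω).2 (hg.isHermitian 1 le_rfl ω) (hρ ω).2.1
    have h4 := dualForm_nonneg (hρ ω).2 (hg.isHermitian 1 le_rfl ω)
    rw [dualLocalNorm_eq (hρ ω).2 (hg.isHermitian 1 le_rfl ω)] at hω
    have h5 : dualForm (ρ 1 ω) (g 1 ω) = 0 :=
      le_antisymm (Real.sqrt_eq_zero'.1 (le_antisymm (hω.trans hG) (Real.sqrt_nonneg _))) h4
    rw [h5, zero_mul] at h3
    exact pow_eq_zero_iff two_ne_zero |>.1 (le_antisymm h3 (sq_nonneg _))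
  rw [h2] at h
  simp at h

lemma IsStochasticOracle.integral_variance_le (hg : IsStochasticOracle μ P A G σ g ρ)
    (hA : IsLossData P A) (hρm : ∀ t, 1 ≤ t → ∀ i j, Measurable fun ω => ρ t ω i j)
    {t : ℕ} (ht : 1 ≤ t) (hρ : ∀ ω, (ρ t ω).PosDef) :
    Integrable (fun ω => dualForm (ρ t ω) (g t ω - lossGradient P A (ρ t ω))) μ ∧
      ∫ ω, dualForm (ρ t ω) (g t ω - lossGradient P A (ρ t ω)) ∂μ ≤ σ ^ 2 := by
  have hH : ∀ ω, (lossGradient P A (ρ t ω)).IsHermitian := fun ω =>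
    hA.isHermitian_lossGradient _
  have e : ∀ ω, dualLocalNorm (ρ t ω) (g t ω - lossGradient P A (ρ t ω)) ^ 2 =
      dualForm (ρ t ω) (g t ω - lossGradient P A (ρ t ω)) := fun ω =>
    dualLocalNorm_sq (hρ ω) ((hg.isHermitian t ht ω).sub (hH ω))
  have hm : AEMeasurable (fun ω => dualForm (ρ t ω) (g t ω - lossGradient P A (ρ t ω))) μ :=
    aemeasurable_dualForm (fun i j => (hρm t ht i j).aemeasurable) fun i j =>
      (hg.measurable t ht i j).aemeasurable.sub (hg.integrable_lossGradient ht i j).aemeasurable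
  -- Integrability is not part of the variance assumption. It follows from the bounds `G` on the
  -- estimate and `1` on the gradient, through `dualForm_add_le`.
  refine ⟨Integrable.of_bound hm.aestronglyMeasurable (2 * G ^ 2 + 2) ?_, ?_⟩
  · filter_upwards [hg.norm_le t ht] with ω hω
    have h0 := dualForm_nonneg (hρ ω) ((hg.isHermitian t ht ω).sub (hH ω))
    have h1 := dualForm_add_le (hρ ω) (hg.isHermitian t ht ω) (isHermitian_smul (hH ω) (-1))
    rw [dualForm_smul, neg_one_smul, ← sub_eq_add_neg] at h1
    have h2 := hA.dualForm_lossGradient_le (hρ ω)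
    have h3 : dualForm (ρ t ω) (g t ω) ≤ G ^ 2 := by
      rw [← dualLocalNorm_sq (hρ ω) (hg.isHermitian t ht ω)]
      refine pow_le_pow_left₀ ?_ hω 2
      rw [dualLocalNorm_eq (hρ ω) (hg.isHermitian t ht ω)]
      positivity
    rw [Real.norm_eq_abs, abs_of_nonneg h0]
    linarith
  · have h1 := hg.variance_le t ht
    simp only [e] at h1
    rw [← integral_condExp (history_le hg.measurable hρm t)]
    refine (integral_mono_ae integrable_condExp (integrable_const _) h1).trans_eq ?_
    simp

end Oracle

/-! ### The self-bounding inequality in expectation. -/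

section Bound

lemma le_of_self_bounding {S L p y : ℝ} (hS : 0 ≤ S) (hL : 3 ≤ L) (hp : 1 ≤ p) (hy : 0 ≤ y)
    (h : S ≤ 1 + Real.sqrt 2 * y + L * (p * (2 * Real.sqrt 2 * Real.sqrt S))) :
    S ≤ 4 * p ^ 2 * L ^ 3 + 2 * y + 1 := by
  have h2 : Real.sqrt 2 ≤ 1.415 := by
    rw [Real.sqrt_le_left (by norm_num)]; norm_num
  have hs := Real.sqrt_nonneg S
  have hs2 := Real.sq_sqrt hS
  set s := Real.sqrt S
  have hLp : 0 ≤ L * p := by positivity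
  have h3 : L * (p * (2 * Real.sqrt 2 * s)) ≤ 2.83 * ((L * p) * s) := by
    have := mul_le_mul_of_nonneg_right h2 (mul_nonneg hLp hs)
    linarith
  have h4 : Real.sqrt 2 * y ≤ 1.415 * y := mul_le_mul_of_nonneg_right h2 hy
  -- The weight `0.29` leaves `0.71 S` on the left, and `1.415 / 0.71 < 2` gives the coefficient of
  -- `y`. The remaining constants are absorbed using `L ≥ 3` and `L * p ≥ 3`.
  have h5 : 2.83 * ((L * p) * s) ≤ 0.29 * s ^ 2 + 6.91 * (L * p) ^ 2 := by
    nlinarith [sq_nonneg (0.58 * s - 2.83 * (L * p)), sq_nonneg (L * p)]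
  have h6 : S ≤ 1.42 + 2 * y + 9.74 * (L * p) ^ 2 := by
    nlinarith [sq_nonneg (L * p)]
  have h7 : 9 ≤ (L * p) ^ 2 := by
    have : 3 ≤ L * p := by nlinarith
    nlinarith
  have h8 : 3 * (L * p) ^ 2 ≤ p ^ 2 * L ^ 3 := by
    have : p ^ 2 * L ^ 3 = L * (L * p) ^ 2 := by ring
    rw [this]
    exact mul_le_mul_of_nonneg_right hL (sq_nonneg _)
  linarith

lemma sqrt_add_le {x y : ℝ} (hx : 0 ≤ x) (hy : 0 ≤ y) :
    Real.sqrt (x + y) ≤ Real.sqrt x + Real.sqrt y := by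
  have h := mul_nonneg (Real.sqrt_nonneg x) (Real.sqrt_nonneg y)
  rw [Real.sqrt_le_left (by positivity), add_sq, Real.sq_sqrt hx, Real.sq_sqrt hy]
  linarith

lemma sqrt_mul_sqrt_le {x z b : ℝ} (hx : 0 ≤ x) (hz : 0 ≤ z) (hb : 0 < b) :
    Real.sqrt x * Real.sqrt z ≤ (x * z / b + b) / 2 := by
  rw [← Real.sqrt_mul hx]
  have h := Real.sq_sqrt (mul_nonneg hx hz)
  set r := Real.sqrt (x * z)
  rw [← h, le_div_iff₀ two_pos, div_add' _ _ _ hb.ne', le_div_iff₀ hb]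
  nlinarith [sq_nonneg (r - b)]

variable {Ξ : Type*} [MeasurableSpace Ξ] {P : Measure Ξ} [IsProbabilityMeasure P] {d : ℕ}
  {A : Ξ → Matrix (Fin d) (Fin d) ℂ} {G m ε : ℝ}

/-- The regret bound of a run of dual averaging in terms of the deviations of the gradient
estimates and of the linearized suboptimality gaps. -/
lemma regret_le_self_bounding (hA : IsLossData P A) (hd : 0 < d) (hG : 0 < G)
    {g ρ : ℕ → Matrix (Fin d) (Fin d) ℂ} (h : IsDualAveraging G g ρ)
    (hg : ∀ t, 1 ≤ t → (g t).IsHermitian) (hgG : ∀ t, 1 ≤ t → dualLocalNorm (ρ t) (g t) ≤ G)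
    (hm : ∀ σ ∈ densityMatrices d, HasFiniteLoss P A σ → m ≤ realLoss P A σ)
    {σ : Matrix (Fin d) (Fin d) ℂ} (hσ : σ.PosDef) (hσ' : σ ∈ densityMatrices d)
    (hε : realLoss P A σ ≤ m + ε) {K : ℝ} (hK0 : 0 ≤ K + 2) (hK : realBarrier σ ≤ d * K)
    (t : ℕ) {b : ℝ} (hb : 0 < b) :
    ∑ τ ∈ Finset.Icc 1 t, (g τ * (ρ τ - σ)).trace.re ≤
      (K + 2) * ((d * (2 * ∑ τ ∈ Finset.Icc 1 t, dualForm (ρ τ) (g τ - lossGradient P A (ρ τ)) +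
        8 * ∑ τ ∈ Finset.Icc 1 t, ((lossGradient P A (ρ τ) * (ρ τ - σ)).trace.re + ε) +
        4 * d * G ^ 2 + G ^ 2) / b + b) / 2) := by
  have hgap : ∀ τ ∈ Finset.Icc 1 t, shiftedNormSq g ρ τ ≤
      2 * dualForm (ρ τ) (g τ - lossGradient P A (ρ τ)) +
        8 * ((lossGradient P A (ρ τ) * (ρ τ - σ)).trace.re + ε) := fun τ hτ => by
    have hτ1 := (Finset.mem_Icc.1 hτ).1
    obtain ⟨k, rfl⟩ := Nat.exists_eq_add_of_le' hτ1
    obtain ⟨hmem, hpd⟩ := h.mem_and_posDef hd k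
    have hH := hA.isHermitian_lossGradient (ρ (k + 1))
    -- The shift of `g` is optimal, so it may be replaced by the shift of the true gradient. The sum
    -- then splits into noise and shifted gradient.
    have h1 := dualForm_alphaShift_le (U := g (k + 1)) hd hpd
      (alphaShift (ρ (k + 1)) (lossGradient P A (ρ (k + 1))))
    have h2 := hA.dualForm_shifted_lossGradient_le hd hpd hmem hm
    have h3 := dualForm_add_le hpd ((hg _ hτ1).sub hH)
      (isHermitian_add_smul_one hH (alphaShift (ρ (k + 1)) (lossGradient P A (ρ (k + 1)))))
    rw [← add_assoc, sub_add_cancel] at h3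
    have h4 := hA.realLoss_sub_le hpd (hA.hasFiniteLoss hpd hmem) (hA.hasFiniteLoss hσ hσ')
    rw [shiftedNormSq]
    linarith
  have h1 := Finset.sum_le_sum hgap
  rw [Finset.sum_add_distrib, ← Finset.mul_sum, ← Finset.mul_sum] at h1
  have h2 := regret_le hd h hG hg hgG t hσ hσ' hK
  refine h2.trans ?_
  rw [mul_comm (Real.sqrt d), mul_assoc]
  refine mul_le_mul_of_nonneg_left ?_ hK0
  -- A free constant `b` makes the bound affine in the random sums. It can then be integrated term
  -- by term and `b` chosen afterwards.
  refine (sqrt_mul_sqrt_le (Nat.cast_nonneg d) (normSqSum_add_pos hd h hG hg t).le hb).trans ?_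
  have h3 : normSqSum G g ρ t + G ^ 2 ≤
      2 * ∑ τ ∈ Finset.Icc 1 t, dualForm (ρ τ) (g τ - lossGradient P A (ρ τ)) +
        8 * ∑ τ ∈ Finset.Icc 1 t, ((lossGradient P A (ρ τ) * (ρ τ - σ)).trace.re + ε) +
        4 * d * G ^ 2 + G ^ 2 := by
    rw [normSqSum]
    linarith
  have hd0 : (0 : ℝ) ≤ d := Nat.cast_nonneg d
  gcongr

variable {Ω : Type*} [MeasurableSpace Ω] {μ : Measure Ω} [IsProbabilityMeasure μ] {σ : ℝ}
  {g ρ : ℕ → Ω → Matrix (Fin d) (Fin d) ℂ}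

/-- The bound on the expected sum of the linearized suboptimality gaps. -/
lemma integral_sum_gap_le (hA : IsLossData P A) (hd : 0 < d)
    (hρm : ∀ t, 1 ≤ t → ∀ i j, Measurable fun ω => ρ t ω i j)
    (hρ : ∀ ω, IsDualAveraging G (fun t => g t ω) (fun t => ρ t ω))
    (hg : IsStochasticOracle μ P A G σ g ρ)
    (hm : ∀ σ ∈ densityMatrices d, HasFiniteLoss P A σ → m ≤ realLoss P A σ)
    {s : Matrix (Fin d) (Fin d) ℂ} (hs : s.PosDef) (hs' : s ∈ densityMatrices d)
    (hε : realLoss P A s ≤ m + ε) {t : ℕ} (hεt : t * ε ≤ 1) {L : ℝ} (hL : 3 ≤ L)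
    (hK : realBarrier s ≤ d * (L - 2)) :
    Integrable (fun ω => ∑ τ ∈ Finset.Icc 1 t,
      ((lossGradient P A (ρ τ ω) * (ρ τ ω - s)).trace.re + ε)) μ ∧
    ∫ ω, ∑ τ ∈ Finset.Icc 1 t, ((lossGradient P A (ρ τ ω) * (ρ τ ω - s)).trace.re + ε) ∂μ ≤
      4 * d * L ^ 3 + 2 * (L * Real.sqrt (σ ^ 2 * d * t + 4 * (d : ℝ) ^ 2 * G ^ 2 + d * G ^ 2)) +
        1 := by
  have hd' : (0 : ℝ) < d := Nat.cast_pos.2 hd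
  have hpd : ∀ τ, 1 ≤ τ → ∀ ω, ρ τ ω ∈ densityMatrices d ∧ (ρ τ ω).PosDef := fun τ hτ ω => by
    obtain ⟨k, rfl⟩ := Nat.exists_eq_add_of_le' hτ
    exact (hρ ω).mem_and_posDef hd k
  have hG : 0 < G := hg.bound_pos hA hρm (hpd 1 le_rfl)
  have hlin : ∀ τ, 1 ≤ τ → _ := fun τ hτ => hg.integral_trace_mul hρm hτ
    (X := fun ω => ρ τ ω - s) (C := 1 + 1)
    (fun i j => (measurable_history g ρ hτ i j).sub_const _)
    (fun i j ω => (norm_sub_le _ _).trans (add_le_add (norm_entry_le_one (hpd τ hτ ω).1 i j)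
      (norm_entry_le_one hs' i j)))
  have hvar : ∀ τ, 1 ≤ τ → _ := fun τ hτ =>
    hg.integral_variance_le hA hρm hτ fun ω => (hpd τ hτ ω).2
  have iD : Integrable (fun ω => ∑ τ ∈ Finset.Icc 1 t,
      dualForm (ρ τ ω) (g τ ω - lossGradient P A (ρ τ ω))) μ :=
    integrable_finsetSum _ fun τ hτ => (hvar τ (Finset.mem_Icc.1 hτ).1).1
  have iY1 : ∀ τ ∈ Finset.Icc 1 t, Integrable (fun ω =>
      (lossGradient P A (ρ τ ω) * (ρ τ ω - s)).trace.re + ε) μ := fun τ hτ =>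
    (hlin τ (Finset.mem_Icc.1 hτ).1).2.1.add (integrable_const ε)
  have iY : Integrable (fun ω => ∑ τ ∈ Finset.Icc 1 t,
      ((lossGradient P A (ρ τ ω) * (ρ τ ω - s)).trace.re + ε)) μ := integrable_finsetSum _ iY1
  refine ⟨iY, ?_⟩
  have iR : Integrable (fun ω => ∑ τ ∈ Finset.Icc 1 t, (g τ ω * (ρ τ ω - s)).trace.re) μ :=
    integrable_finsetSum _ fun τ hτ => (hlin τ (Finset.mem_Icc.1 hτ).1).1
  have eR : ∫ ω, ∑ τ ∈ Finset.Icc 1 t, ((lossGradient P A (ρ τ ω) * (ρ τ ω - s)).trace.re + ε) ∂μ =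
      ∫ ω, ∑ τ ∈ Finset.Icc 1 t, (g τ ω * (ρ τ ω - s)).trace.re ∂μ + t * ε := by
    rw [integral_finsetSum _ iY1,
      integral_finsetSum _ fun τ hτ => (hlin τ (Finset.mem_Icc.1 hτ).1).1]
    have : (t : ℝ) * ε = ∑ τ ∈ Finset.Icc 1 t, ε := by simp
    rw [this, ← Finset.sum_add_distrib]
    refine Finset.sum_congr rfl fun τ hτ => ?_
    obtain ⟨-, h1, h2⟩ := hlin τ (Finset.mem_Icc.1 hτ).1
    rw [integral_add h1 (integrable_const ε), h2]
    simp
  have eD : ∫ ω, ∑ τ ∈ Finset.Icc 1 t,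
      dualForm (ρ τ ω) (g τ ω - lossGradient P A (ρ τ ω)) ∂μ ≤ t * σ ^ 2 := by
    rw [integral_finsetSum _ fun τ hτ => (hvar τ (Finset.mem_Icc.1 hτ).1).1]
    refine (Finset.sum_le_sum fun τ hτ => (hvar τ (Finset.mem_Icc.1 hτ).1).2).trans_eq ?_
    simp
  -- Each linearized gap is at least `f(ρ_τ) - f(s) ≥ -ε` by convexity, which is why `ε` is added to
  -- it.
  have hY0 : 0 ≤ ∫ ω, ∑ τ ∈ Finset.Icc 1 t,
      ((lossGradient P A (ρ τ ω) * (ρ τ ω - s)).trace.re + ε) ∂μ := by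
    refine integral_nonneg fun ω => Finset.sum_nonneg fun τ hτ => ?_
    obtain ⟨h1, h2⟩ := hpd τ (Finset.mem_Icc.1 hτ).1 ω
    have h3 := hA.realLoss_sub_le h2 (hA.hasFiniteLoss h2 h1) (hA.hasFiniteLoss hs hs')
    have h4 := hm _ h1 (hA.hasFiniteLoss h2 h1)
    linarith
  have hgG : ∀ᵐ ω ∂μ, ∀ τ, 1 ≤ τ → dualLocalNorm (ρ τ ω) (g τ ω) ≤ G := by
    rw [ae_all_iff]
    intro τ
    by_cases hτ : 1 ≤ τ
    · filter_upwards [hg.norm_le τ hτ] with ω hω _ using hω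
    · exact Filter.Eventually.of_forall fun ω h => absurd h hτ
  set Y := fun ω => ∑ τ ∈ Finset.Icc 1 t,
    ((lossGradient P A (ρ τ ω) * (ρ τ ω - s)).trace.re + ε) with hYdef
  set D := fun ω => ∑ τ ∈ Finset.Icc 1 t,
    dualForm (ρ τ ω) (g τ ω - lossGradient P A (ρ τ ω)) with hDdef
  set R := fun ω => ∑ τ ∈ Finset.Icc 1 t, (g τ ω * (ρ τ ω - s)).trace.re
  set S := ∫ ω, Y ω ∂μ
  set B := σ ^ 2 * d * t + 4 * (d : ℝ) ^ 2 * G ^ 2 + d * G ^ 2 with hB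
  have hB0 : 0 ≤ B := by positivity
  set Q := d * (2 * (t * σ ^ 2) + 8 * S + 4 * d * G ^ 2 + G ^ 2) with hQ
  have hQ0 : 0 < Q := by positivity
  -- `Q` bounds the expectation of the affine numerator, so this choice gives `(Q / b + b) / 2 = b`,
  -- which plays the role of Jensen's inequality for the square root.
  set b := Real.sqrt Q with hbdef
  have hb : 0 < b := Real.sqrt_pos.2 hQ0
  have hR : ∀ᵐ ω ∂μ, R ω ≤
      L * ((d * (2 * D ω + 8 * Y ω + 4 * d * G ^ 2 + G ^ 2) / b + b) / 2) := by
    filter_upwards [hgG] with ω hω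
    have := regret_le_self_bounding hA hd hG (hρ ω) (fun τ hτ => hg.isHermitian τ hτ ω) hω hm hs
      hs' hε (K := L - 2) (by linarith) hK t hb
    rwa [sub_add_cancel] at this
  have i1 : Integrable (fun ω => 2 * D ω + 8 * Y ω) μ := (iD.const_mul 2).add (iY.const_mul 8)
  have eZ : ∫ ω, L * ((d * (2 * D ω + 8 * Y ω + 4 * d * G ^ 2 + G ^ 2) / b + b) / 2) ∂μ =
      L * ((d * (2 * ∫ ω, D ω ∂μ + 8 * S + 4 * d * G ^ 2 + G ^ 2) / b + b) / 2) := by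
    have e : ∀ ω, L * ((d * (2 * D ω + 8 * Y ω + 4 * d * G ^ 2 + G ^ 2) / b + b) / 2) =
        L * d / (2 * b) * (2 * D ω + 8 * Y ω) +
          L * ((d * (4 * d * G ^ 2 + G ^ 2) / b + b) / 2) := fun ω => by
      field_simp; ring
    simp only [e]
    rw [integral_add (i1.const_mul _) (integrable_const _), integral_const_mul,
      integral_add (iD.const_mul 2) (iY.const_mul 8), integral_const_mul, integral_const_mul]
    simp only [integral_const, probReal_univ, one_smul]
    field_simp
    ring
  have iZ : Integrable (fun ω =>
      L * ((d * (2 * D ω + 8 * Y ω + 4 * d * G ^ 2 + G ^ 2) / b + b) / 2)) μ :=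
    ((((((i1.add (integrable_const _)).add (integrable_const _)).const_mul _).div_const _).add
      (integrable_const _)).div_const _).const_mul _
  have h1 := integral_mono_ae iR iZ hR
  rw [eZ] at h1
  have h2 : L * ((d * (2 * ∫ ω, D ω ∂μ + 8 * S + 4 * d * G ^ 2 + G ^ 2) / b + b) / 2) ≤ L * b := by
    have h3 : d * (2 * ∫ ω, D ω ∂μ + 8 * S + 4 * d * G ^ 2 + G ^ 2) / b ≤ b := by
      rw [div_le_iff₀ hb, hbdef, Real.mul_self_sqrt hQ0.le, hQ]
      gcongr
    refine mul_le_mul_of_nonneg_left ?_ (by linarith)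
    linarith
  have h3 : b ≤ Real.sqrt 2 * Real.sqrt B + Real.sqrt d * (2 * Real.sqrt 2 * Real.sqrt S) := by
    have h8 : Real.sqrt 8 = 2 * Real.sqrt 2 := by
      rw [show (8 : ℝ) = 2 ^ 2 * 2 by norm_num, Real.sqrt_mul (by norm_num),
        Real.sqrt_sq (by norm_num)]
    calc b ≤ Real.sqrt (2 * B + d * (8 * S)) := by
          refine Real.sqrt_le_sqrt ?_
          rw [hQ, hB]
          have : 0 ≤ (d : ℝ) ^ 2 * G ^ 2 := by positivity
          have : 0 ≤ (d : ℝ) * G ^ 2 := by positivity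
          linarith
      _ ≤ Real.sqrt (2 * B) + Real.sqrt (d * (8 * S)) := sqrt_add_le (by positivity) (by positivity)
      _ = _ := by
        rw [Real.sqrt_mul (by norm_num), Real.sqrt_mul hd'.le, Real.sqrt_mul (by norm_num), h8]
  have h4 := mul_le_mul_of_nonneg_left h3 (show 0 ≤ L by linarith)
  have h5 := le_of_self_bounding (S := S) (L := L) (p := Real.sqrt d) (y := L * Real.sqrt B)
    hY0 hL (Real.one_le_sqrt.2 (by exact_mod_cast hd)) (by positivity) (by linarith)
  rwa [Real.sq_sqrt hd'.le] at h5

end Bound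

end LogLossSDA

/-! ### The main theorem: choice of the comparator and conclusion. -/

theorem mainTheorem1 {d : ℕ} (hd : 0 < d)
    {Ξ : Type*} [MeasurableSpace Ξ] (P : Measure Ξ) [IsProbabilityMeasure P]
    (A : Ξ → Matrix (Fin d) (Fin d) ℂ)
    (hA_meas : ∀ i j, Measurable fun ξ => A ξ i j)
    (hA_psd : ∀ᵐ ξ ∂P, (A ξ).PosSemidef) (hA_ne : ∀ᵐ ξ ∂P, A ξ ≠ 0)
    (hA_log : Integrable (fun ξ => Real.log (A ξ).trace.re) P)
    {Ω : Type*} [MeasurableSpace Ω] (μ : Measure Ω) [IsProbabilityMeasure μ]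
    (G σ : ℝ) (g ρ : ℕ → Ω → Matrix (Fin d) (Fin d) ℂ)
    (hρ_meas : ∀ t : ℕ, 1 ≤ t → ∀ i j, Measurable fun ω => ρ t ω i j)
    (hρ : ∀ ω, LogLossSDA.IsDualAveraging G (fun t => g t ω) (fun t => ρ t ω))
    (hg : LogLossSDA.IsStochasticOracle μ P A G σ g ρ) :
    ∃ fmin : ℝ,
      IsLeast (LogLossSDA.expLogLoss P A '' LogLossSDA.densityMatrices d) (fmin : EReal) ∧
      ∀ t : ℕ, 1 ≤ t →
        LogLossSDA.expectation μ
            (fun ω => LogLossSDA.expLogLoss P A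
              (LogLossSDA.averagedIterate (fun τ => ρ τ ω) t) - (fmin : EReal))
          ≤ (((4 * d * (3 + Real.log t) ^ 3
              + 2 * (3 + Real.log t) *
                Real.sqrt (σ ^ 2 * d * t + 4 * (d : ℝ) ^ 2 * G ^ 2 + d * G ^ 2)
              + 1) / t : ℝ) : EReal) := by
  have hA : LogLossSDA.IsLossData P A := ⟨hA_meas, hA_psd, hA_ne, hA_log⟩
  have hd' : (0 : ℝ) < d := Nat.cast_pos.2 hd
  obtain ⟨r, hr, hrf, hmin, hleast⟩ := hA.exists_min hd
  refine ⟨LogLossSDA.realLoss P A r, hleast, fun t ht => ?_⟩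
  have ht' : (1 : ℝ) ≤ t := by exact_mod_cast ht
  have ht0 : (0 : ℝ) < t := by linarith
  -- Moving the minimizer by a fraction `1 / (t + 1)` towards `I/d` costs `-log c ≤ 1/t` per round,
  -- at most `1` in total, and brings the barrier down to `d log (t + 1)`.
  obtain ⟨c, hc⟩ : ∃ c : ℝ, c = t / (t + 1) := ⟨_, rfl⟩
  have hc0 : 0 < c := by rw [hc]; positivity
  have hc2 : 1 - c = (t + 1 : ℝ)⁻¹ := by rw [hc]; field_simp; ring
  have hc1 : 0 < 1 - c := by rw [hc2]; positivity
  have hlog : t * -Real.log c ≤ 1 := by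
    have h1 := Real.log_le_sub_one_of_pos (inv_pos.2 hc0)
    rw [Real.log_inv] at h1
    have h2 : c⁻¹ - 1 = 1 / t := by rw [hc]; field_simp; ring
    rw [h2] at h1
    calc t * -Real.log c ≤ t * (1 / t) := mul_le_mul_of_nonneg_left h1 ht0.le
      _ = 1 := by field_simp
  have hpsd : (c • r).PosSemidef := hr.1.smul hc0.le
  have hspd : (c • r + ((1 - c) / d) • (1 : Matrix (Fin d) (Fin d) ℂ)).PosDef :=
    (LogLossSDA.posDef_smul_one (div_pos hc1 hd')).posSemidef_add hpsd
  have hsmem : c • r + ((1 - c) / d) • (1 : Matrix (Fin d) (Fin d) ℂ) ∈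
      LogLossSDA.densityMatrices d := by
    have := LogLossSDA.smul_add_smul_mem_densityMatrices hr
      (LogLossSDA.smul_one_mem_densityMatrices hd) hc0.le hc1.le (by ring)
    rwa [smul_smul, ← div_eq_mul_inv] at this
  have hε := hA.realLoss_mix_le hrf hc0 (hA.hasFiniteLoss hspd hsmem) (by linarith)
  have hK : LogLossSDA.realBarrier (c • r + ((1 - c) / d) • (1 : Matrix (Fin d) (Fin d) ℂ)) ≤
      d * ((3 + Real.log t) - 2) := by
    refine (LogLossSDA.realBarrier_add_smul_one_le hd hpsd hc1).trans ?_
    rw [hc2, Real.log_inv, neg_mul_neg]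
    refine mul_le_mul_of_nonneg_left ?_ hd'.le
    -- This gives `log (t + 1) ≤ log t + 1`. The `1` here and the `2` of the regret bound make up
    -- the `3` in the theorem.
    have h1 := Real.log_le_sub_one_of_pos (show 0 < (t + 1 : ℝ) / t by positivity)
    rw [Real.log_div (by positivity) ht0.ne'] at h1
    have h2 : (t + 1 : ℝ) / t - 1 ≤ 1 := by
      rw [sub_le_iff_le_add, div_le_iff₀ ht0]; linarith
    linarith
  obtain ⟨hint, hbound⟩ := LogLossSDA.integral_sum_gap_le hA hd hρ_meas hρ hg hmin hspd hsmem
    (ε := -Real.log c) (by linarith) hlog (L := 3 + Real.log t)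
    (by linarith [Real.log_nonneg ht']) hK
  have hpd : ∀ ω τ, 1 ≤ τ → ρ τ ω ∈ LogLossSDA.densityMatrices d ∧ (ρ τ ω).PosDef :=
    fun ω τ hτ => by
      obtain ⟨k, rfl⟩ := Nat.exists_eq_add_of_le' hτ
      exact (hρ ω).mem_and_posDef hd k
  have havg : ∀ ω, LogLossSDA.HasFiniteLoss P A
      (LogLossSDA.averagedIterate (fun τ => ρ τ ω) t) := fun ω =>
    hA.hasFiniteLoss (LogLossSDA.averagedIterate_posDef ht fun τ hτ => (hpd ω τ hτ).2)
      (LogLossSDA.averagedIterate_mem ht fun τ hτ => (hpd ω τ hτ).1)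
  -- The linearized gaps serve as the integrable majorant. Nonnegativity comes from minimality of
  -- `r`, the majorization from convexity.
  refine (LogLossSDA.expectation_le_coe (hint.const_mul (t : ℝ)⁻¹)
    (Filter.Eventually.of_forall fun ω => ?_) (Filter.Eventually.of_forall fun ω => ?_)).trans ?_
  · rw [(havg ω).expLogLoss_eq, ← EReal.coe_sub, ← EReal.coe_zero, EReal.coe_le_coe_iff, sub_nonneg]
    exact hmin _ (LogLossSDA.averagedIterate_mem ht fun τ hτ => (hpd ω τ hτ).1) (havg ω)
  · rw [(havg ω).expLogLoss_eq, ← EReal.coe_sub, EReal.coe_le_coe_iff]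
    have h1 := LogLossSDA.realLoss_averagedIterate_le ht
      (fun τ hτ => hA.hasFiniteLoss (hpd ω τ hτ).2 (hpd ω τ hτ).1) (havg ω)
    have h2 : LogLossSDA.realLoss P A r =
        (t : ℝ)⁻¹ * ∑ τ ∈ Finset.Icc 1 t, LogLossSDA.realLoss P A r := by
      simp [ht0.ne']
    rw [sub_le_iff_le_add, h2, ← mul_add, ← Finset.sum_add_distrib]
    refine h1.trans (mul_le_mul_of_nonneg_left (Finset.sum_le_sum fun τ hτ => ?_) (by positivity))
    obtain ⟨h3, h4⟩ := hpd ω τ (Finset.mem_Icc.1 hτ).1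
    have h5 := hA.realLoss_sub_le h4 (hA.hasFiniteLoss h4 h3) (hA.hasFiniteLoss hspd hsmem)
    linarith
  · rw [EReal.coe_le_coe_iff, integral_const_mul, inv_mul_eq_div]
    refine div_le_div_of_nonneg_right (hbound.trans_eq ?_) ht0.le
    ring
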